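/- Let $X$ be a smooth Fano manifold (compact and connected) of complex dimension $m$, let $\mathbb T\subset \mathrm{Aut}(X)$ be a compact torus with Lie algebra $\mathfrak t$, and let $\omega\in 2\pi c_1(X)$ be a $\mathbb T$-invariant Kähler metric, with Riemannian metric $g_\omega$ ($\omega=g_\omega(J\cdot,\cdot)$) and Ricci form $\rho_\omega$. Let $\mu_\omega:X\to\mathfrak t^*$ be its momentum map, $d\langle\mu_\omega,\xi\rangle=-\omega(\xi,\cdot)$, with the canonical normalization, i.e. the one determined by the natural action of $\mathbb T$ on $K_X^{-1}$: $\mathcal L_\xi s=\nabla_\xi s+\sqrt{-1}\,\langle\mu_\omega,\xi\rangle s$ for all $\xi\in\mathfrak t$ and all local sections $s$ of $K_X^{-1}$, where $\nabla$ is the Chern connection of a hermitian metric on $K_X^{-1}$ with curvature form $\omega$. Let $\Delta=\mu_\omega(X)$ and let $v>0$ be a positive smooth function on $\Delta$ (the restriction of a smooth function on a neighbourhood of $\Delta$). Then $\omega$ is a $v$-soliton, i.e. $$\rho_\omega-\omega=\tfrac12\,dd^c\log v(\mu_\omega),\qquad d^cf=-df\circ J,$$ if and only if $\omega$ is $(v,w)$-cscK,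 i.e. $$\mathrm{Scal}_v(\omega):=v(\mu_\omega)\,\mathrm{Scal}(\omega)+2\Delta_\omega\big(v(\mu_\omega)\big)+\big\langle g_\omega,\mu_\omega^*(\mathrm{Hess}(v))\big\rangle=w(\mu_\omega),$$ with the weight $$w(x)=2\big(m+\langle d\log v(x),x\rangle\big)v(x),\qquad x\in\Delta.$$ Here $\mathrm{Scal}(\omega)$ is the scalar curvature of $g_\omega$, $\Delta_\omega=\delta d$ is its (non-negative) Laplace operator on functions, and $\langle g_\omega,\mu_\omega^*(\mathrm{Hess}(v))\rangle=\sum_{i,j}v_{,ij}(\mu_\omega)\,g_\omega(\xi_i,\xi_j)$ for a basis $(\xi_i)$ of $\mathfrak t$, where $v_{,ij}$ are the second partial derivatives of $v$ with respect to the corresponding linear coordinates on $\mathfrak t^*$. -/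

import Mathlib

set_option maxSynthPendingDepth 3

open scoped Manifold ContDiff Topology

noncomputable section

namespace WeightedKahler

/-! ### Riemannian geometry on open subsets of a real vector space

The definitions of this and of the next section are applied below to the coordinate expressions of
global objects in charts. The derivatives `fderiv ℝ` are real (Fréchet) derivatives. -/

section Riemannian

variable {V : Type*} [NormedAddCommGroup V] [NormedSpace ℝ V]

/-- Real bilinear forms on `V`. -/
abbrev BilForm (V : Type*) [NormedAddCommGroup V] [NormedSpace ℝ V] : Type _ := V →L[ℝ] V →L[ℝ] ℝ

/-- The trilinear form `½ (∂_u g(w, y) + ∂_w g(u, y) - ∂_y g(u, w))`. -/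
def koszul (G : V → BilForm V) (z : V) : V →L[ℝ] V →L[ℝ] V →L[ℝ] ℝ :=
  (1 / 2 : ℝ) • (fderiv ℝ G z + (fderiv ℝ G z).flip
    - (ContinuousLinearMap.flipₗᵢ ℝ V V ℝ).toContinuousLinearEquiv.toContinuousLinearMap.comp
        (fderiv ℝ G z).flip)

theorem koszul_apply (G : V → BilForm V) (z u w y : V) :
    koszul G z u w y =
      1 / 2 * (fderiv ℝ G z u w y + fderiv ℝ G z w u y - fderiv ℝ G z y u w) := by
  simp [koszul]

/-- The Christoffel form `Γ(u, w)` of the Levi-Civita connection `∇_u w = ∂_u w + Γ(u, w)` of the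
Riemannian metric `G`: the vector dual to `koszul G z u w` with respect to `G`. -/
def christoffel (G : V → BilForm V) (z : V) : V →L[ℝ] V →L[ℝ] V :=
  (ContinuousLinearMap.compL ℝ V (V →L[ℝ] ℝ) V (G z).inverse).comp (koszul G z)

theorem christoffel_apply (G : V → BilForm V) (z u w : V) :
    christoffel G z u w = (G z).inverse (koszul G z u w) := rfl

/-- The Riemann curvature `R(u, v) w = ∇_u ∇_v w - ∇_v ∇_u w - ∇_[u,v] w` of `G`. -/
def riemann (G : V → BilForm V) (z u v w : V) : V :=
  fderiv ℝ (christoffel G) z u v w - fderiv ℝ (christoffel G) z v u w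
    + christoffel G z u (christoffel G z v w) - christoffel G z v (christoffel G z u w)

variable [FiniteDimensional ℝ V]

/-- The coordinate functionals `bᵃ` of a real basis `b_a` of `V`. -/
def realCoord (a : Fin (Module.finrank ℝ V)) : V →L[ℝ] ℝ :=
  LinearMap.toContinuousLinearMap ((Module.finBasis ℝ V).coord a)

/-- The trace of a real-linear endomorphism of `V`. -/
def realTrace (L : V → V) : ℝ := ∑ a, realCoord a (L (Module.finBasis ℝ V a))

/-- The trace `∑ gᵃᵇ B(b_a, b_b)` of a bilinear form `B` with respect to an inner product `g`
(here `g.inverse` is the inverse of the isomorphism `u ↦ g(u, ·)` onto the dual space). -/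
def metricTrace (g : BilForm V) (B : V → V → ℝ) : ℝ :=
  ∑ a, B (Module.finBasis ℝ V a) (g.inverse (realCoord a))

/-- The Ricci tensor `Ric(v, w) = tr (u ↦ R(u, v) w)` of `G`. -/
def ricciTensor (G : V → BilForm V) (z v w : V) : ℝ :=
  realTrace fun u => riemann G z u v w

/-- The scalar curvature of the Riemannian metric `G`. -/
def scalarCurv (G : V → BilForm V) (z : V) : ℝ :=
  metricTrace (G z) (ricciTensor G z)

/-- The Hessian `∇df` of `f` with respect to the Levi-Civita connection of `G`. -/
def hessian (G : V → BilForm V) (f : V → ℝ) (z u w : V) : ℝ :=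
  fderiv ℝ (fderiv ℝ f) z u w - fderiv ℝ f z (christoffel G z u w)

/-- The Riemannian Laplacian `Δf = δdf = -tr_G ∇df`, with the sign that makes it a non-negative
operator. -/
def laplacian (G : V → BilForm V) (f : V → ℝ) (z : V) : ℝ :=
  -metricTrace (G z) (hessian G f z)

/-- The exterior derivative of a real 1-form. -/
def extD1 (β : V → V →L[ℝ] ℝ) (z u w : V) : ℝ :=
  fderiv ℝ β z u w - fderiv ℝ β z w u

/-- The exterior derivative of a real 2-form. -/
def extD2 (Ω : V → BilForm V) (z u v w : V) : ℝ :=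
  fderiv ℝ Ω z u v w - fderiv ℝ Ω z v u w + fderiv ℝ Ω z w u v

end Riemannian

/-! ### Complex tensor calculus on open subsets of a complex vector space -/

variable {E : Type*} [NormedAddCommGroup E] [NormedSpace ℂ E] [FiniteDimensional ℂ E]

variable (E) in
/-- The complex structure `J` of `E` (multiplication by `i`). -/
def cplxJ : E →L[ℝ] E :=
  (Complex.I • ContinuousLinearMap.id ℂ E).restrictScalars ℝ

/-- The basis `e₁, …, eₘ` of the model space `E ≅ ℂᵐ`, `m = dim E`. -/
def stdVec (j : Fin (Module.finrank ℂ E)) : E := Module.finBasis ℂ E j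

/-- The Ricci form `ρ(u, v) = Ric(Ju, v)`. -/
def ricciForm (G : E → BilForm E) (z u v : E) : ℝ :=
  ricciTensor G z (cplxJ E u) v

/-- The twisted differential `dᶜf = J df = -df ∘ J`. -/
def dc (f : E → ℝ) (z : E) : E →L[ℝ] ℝ :=
  -((fderiv ℝ f z).comp (cplxJ E))

/-- The 2-form `ddᶜf` (which is `2i∂∂̄f`). -/
def ddc (f : E → ℝ) (z u w : E) : ℝ := extD1 (dc f) z u w

/-- The 2-form `Ω(u, w) = G(Ju, w)` of a `J`-invariant metric `G`. -/
def fundForm (G : E → BilForm E) (z : E) : BilForm E := (G z).comp (cplxJ E)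

/-- The value `∂f(u) = ½ (df(u) - i df(Ju))` of the `(1,0)`-form `∂f` on a real vector `u`. -/
def delForm (f : E → ℝ) (z u : E) : ℂ :=
  (1 / 2 : ℂ) * ((fderiv ℝ f z u : ℂ) - Complex.I * (fderiv ℝ f z (cplxJ E u) : ℂ))

/-! ### Complex manifolds, Kähler metrics, hermitian metrics on the anticanonical bundle

A complex manifold of dimension `m` is a space `X` with a holomorphic atlas modelled on a complex
vector space `E` of dimension `m`. Its real tangent space at `x` is the complex vector space
`TangentSpace 𝓘(ℂ, E) x` regarded as a real vector space, with `J` the multiplication by `i`; it is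
identified, as usual, with the holomorphic tangent space. -/

variable {X : Type*} [TopologicalSpace X] [ChartedSpace E X]

/-- The real tangent space at `x`, with its complex structure. -/
abbrev Tan (E : Type*) [NormedAddCommGroup E] [NormedSpace ℂ E] {X : Type*} [TopologicalSpace X]
    [ChartedSpace E X] (x : X) : Type _ :=
  TangentSpace 𝓘(ℂ, E) x

/-- The differential at `z` of the inverse of a chart `e`; it sends `eⱼ` to the coordinate vector
field `∂ⱼ` of `e`. -/
def chartFrame (e : OpenPartialHomeomorph X E) (z : E) :
    E →ₗ[ℂ] Tan E (e.symm z) :=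
  (mfderiv 𝓘(ℂ, E) 𝓘(ℂ, E) e.symm z).toLinearMap

/-- The expression in a chart `e` of a field of real bilinear forms on the tangent spaces. -/
def localBil (g : ∀ x : X, Tan E x →ₗ[ℝ] Tan E x →ₗ[ℝ] ℝ)
    (e : OpenPartialHomeomorph X E) (z : E) : BilForm E :=
  LinearMap.toContinuousBilinearMap
    ((g (e.symm z)).compl₁₂ ((chartFrame e z).restrictScalars ℝ)
      ((chartFrame e z).restrictScalars ℝ))

variable (E X) in
/-- A (smooth) Kähler metric on `X`: a `J`-invariant Riemannian metric `g` whose fundamental form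
`Ω = g(J·, ·)` is closed. -/
structure KahlerMetric where
  /-- The Riemannian metric. -/
  g : ∀ x : X, Tan E x →ₗ[ℝ] Tan E x →ₗ[ℝ] ℝ
  symm : ∀ (x : X) (u w : Tan E x), g x u w = g x w u
  pos : ∀ (x : X) (u : Tan E x), u ≠ 0 → 0 < g x u u
  invJ : ∀ (x : X) (u w : Tan E x), g x (Complex.I • u) (Complex.I • w) = g x u w
  smooth : ∀ e ∈ atlas E X, ContDiffOn ℝ ∞ (localBil g e) e.target
  closed : ∀ e ∈ atlas E X, ∀ z ∈ e.target, ∀ u v w : E,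
    extD2 (fundForm (localBil g e)) z u v w = 0

/-- The expression of the Riemannian metric in a chart. -/
def KahlerMetric.loc (Ω : KahlerMetric E X) (e : OpenPartialHomeomorph X E) :
    E → BilForm E := localBil Ω.g e

/-- The local frame `∂₁ ∧ ⋯ ∧ ∂ₘ` of the anticanonical bundle `K_X⁻¹ = Λᵐ TX` given by a chart. -/
def anticanFrame (e : OpenPartialHomeomorph X E) (z : E) : ⋀[ℂ]^(Module.finrank ℂ E) (Tan E (e.symm z)) :=
  exteriorPower.ιMulti ℂ (Module.finrank ℂ E) fun j => chartFrame e z (stdVec j)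

variable (E X) in
/-- A smooth hermitian metric on the holomorphic line bundle `K_X⁻¹`, given by its squared norm
`s ↦ |s|²` on the fibres `Λᵐ T_xX`, which are complex lines. -/
structure AnticanMetric where
  /-- The squared norm. -/
  normSq : ∀ x : X, ⋀[ℂ]^(Module.finrank ℂ E) (Tan E x) → ℝ
  normSq_smul : ∀ (x : X) (c : ℂ) (s : ⋀[ℂ]^(Module.finrank ℂ E) (Tan E x)),
    normSq x (c • s) = ‖c‖ ^ 2 * normSq x s
  pos : ∀ (x : X) (s : ⋀[ℂ]^(Module.finrank ℂ E) (Tan E x)), s ≠ 0 → 0 < normSq x s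
  smooth : ∀ e ∈ atlas E X,
    ContDiffOn ℝ ∞ (fun z => normSq (e.symm z) (anticanFrame e z)) e.target

/-- The function `log |∂₁ ∧ ⋯ ∧ ∂ₘ|²` in a chart. -/
def AnticanMetric.logNorm (H : AnticanMetric E X) (e : OpenPartialHomeomorph X E)
    (z : E) : ℝ :=
  Real.log (H.normSq (e.symm z) (anticanFrame e z))

/-- `Ω` is the curvature form `i F = -i∂∂̄ log |s|² = -½ ddᶜ log |s|²` (`s` a local holomorphic
frame) of the Chern connection of the hermitian metric `H` on `K_X⁻¹`. -/
def IsCurvatureForm (H : AnticanMetric E X) (Ω : KahlerMetric E X) : Prop :=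
  ∀ e ∈ atlas E X, ∀ z ∈ e.target, ∀ u w : E,
    fundForm (Ω.loc e) z u w = -(1 / 2) * ddc (H.logNorm e) z u w

/-- `Ω ∈ 2πc₁(X)`: the Kähler form is the curvature form of a (smooth) hermitian metric on `K_X⁻¹`.
(A compact complex manifold carrying such an `Ω` is precisely a Fano manifold.) -/
def InTwoPiC1 (Ω : KahlerMetric E X) : Prop := ∃ H : AnticanMetric E X, IsCurvatureForm H Ω

/-! ### Torus actions and canonically normalized momentum maps -/

/-- The compact torus `(S¹)ʳ`. Its Lie algebra is `𝔱 = ℝʳ`. -/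
abbrev Torus (r : ℕ) : Type := Fin r → Circle

/-- The dual `𝔱*` of the Lie algebra of the torus. -/
abbrev TorusDual (r : ℕ) : Type := (Fin r → ℝ) →L[ℝ] ℝ

/-- The exponential map of the torus. -/
def torusExp {r : ℕ} (a : Fin r → ℝ) : Torus r := fun j => Circle.exp (a j)

variable {r : ℕ} [MulAction (Torus r) X]

variable (E X r) in
/-- The torus acts smoothly on `X` by biholomorphisms. (Smoothness of `𝕋 × X → X` is expressed
through the covering map `torusExp`.) -/
structure IsHolomorphicAction : Prop where
  smooth : ContMDiff (𝓘(ℝ, Fin r → ℝ).prod 𝓘(ℝ, E)) 𝓘(ℝ, E) ∞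
    fun p : (Fin r → ℝ) × X => torusExp p.1 • p.2
  holomorphic : ∀ t : Torus r, ContMDiff 𝓘(ℂ, E) 𝓘(ℂ, E) ω fun x : X => t • x

variable (r) in
/-- The Kähler metric is invariant under the torus. -/
def KahlerMetric.IsInvariant (Ω : KahlerMetric E X) : Prop :=
  ∀ (t : Torus r) (x : X) (u w : Tan E x),
    Ω.g (t • x) (mfderiv 𝓘(ℂ, E) 𝓘(ℂ, E) (fun y : X => t • y) x u)
      (mfderiv 𝓘(ℂ, E) 𝓘(ℂ, E) (fun y : X => t • y) x w) = Ω.g x u w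

/-- The vector field on `X` induced by `ξ ∈ 𝔱`, in a chart. -/
def fundField (ξ : Fin r → ℝ) (e : OpenPartialHomeomorph X E) (z : E) : E :=
  deriv (fun t : ℝ => e (torusExp (t • ξ) • e.symm z)) 0

/-- `μ : X → 𝔱*` is a momentum map of the torus action on `(X, Ω)`: it is smooth, invariant, and
`d⟨μ, ξ⟩ = -Ω(ξ, ·)` for all `ξ ∈ 𝔱`. -/
structure IsMomentumMap (Ω : KahlerMetric E X) (μ : X → TorusDual r) : Prop where
  smooth : ContMDiff 𝓘(ℝ, E) 𝓘(ℝ, TorusDual r) ∞ μ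
  invariant : ∀ (t : Torus r) (x : X), μ (t • x) = μ x
  hamiltonian : ∀ e ∈ atlas E X, ∀ z ∈ e.target, ∀ (ξ : Fin r → ℝ) (u : E),
    fderiv ℝ (fun y => μ (e.symm y) ξ) z u = -fundForm (Ω.loc e) z (fundField ξ e z) u

/-- The infinitesimal natural action of `ξ ∈ 𝔱` on `K_X⁻¹`: the coefficient `a` in
`ℒ_ξ (∂₁ ∧ ⋯ ∧ ∂ₘ) = ∑ⱼ ∂₁ ∧ ⋯ ∧ [ξ, ∂ⱼ] ∧ ⋯ ∧ ∂ₘ = a ∂₁ ∧ ⋯ ∧ ∂ₘ`. -/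
def lieCoeff (ξ : Fin r → ℝ) (e : OpenPartialHomeomorph X E) (z : E) : ℂ :=
  ∑ j, (Module.finBasis ℂ E).coord j
    (VectorField.lieBracket ℝ (fundField ξ e) (fun _ => stdVec j) z)

/-- The Chern connection of `H`: the coefficient `a = ∂ log |s|² (ξ)` in `∇_ξ s = a s`, for the
local holomorphic frame `s = ∂₁ ∧ ⋯ ∧ ∂ₘ`. -/
def chernCoeff (H : AnticanMetric E X) (ξ : Fin r → ℝ) (e : OpenPartialHomeomorph X E)
    (z : E) : ℂ :=
  delForm (H.logNorm e) z (fundField ξ e z)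

/-- For `Ω` in `2πc₁(X)`: `μ` is the canonically normalized momentum map of `(X, Ω)`, i.e. the
momentum map determined by the natural action of the torus on `K_X⁻¹`, that is
`ℒ_ξ s = ∇_ξ s + i ⟨μ, ξ⟩ s` for the Chern connection `∇` of a hermitian metric on
`K_X⁻¹` with curvature form `Ω`. (Both sides being derivations in `s`, it is enough to say this for
local frames.) -/
def IsCanonicalMomentumMap (Ω : KahlerMetric E X) (μ : X → TorusDual r) : Prop :=
  IsMomentumMap Ω μ ∧ ∃ H : AnticanMetric E X, IsCurvatureForm H Ω ∧
    ∀ e ∈ atlas E X, ∀ z ∈ e.target, ∀ ξ : Fin r → ℝ,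
      lieCoeff ξ e z = chernCoeff H ξ e z + Complex.I * (μ (e.symm z) ξ : ℂ)

/-! ### Weighted solitons and weighted constant scalar curvature -/

/-- `Ω` is a `v`-soliton: `ρ_Ω - Ω = ½ ddᶜ log v(μ)`. -/
def IsSoliton (Ω : KahlerMetric E X) (μ : X → TorusDual r) (v : TorusDual r → ℝ) : Prop :=
  ∀ e ∈ atlas E X, ∀ z ∈ e.target, ∀ u w : E,
    ricciForm (Ω.loc e) z u w - fundForm (Ω.loc e) z u w
      = (1 / 2) * ddc (fun y => Real.log (v (μ (e.symm y)))) z u w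

/-- The contraction `⟨g, μ^* Hess v⟩ = ∑ v_{,ij}(μ) g(ξᵢ, ξⱼ)`, where `ξᵢ` is the standard basis
of `𝔱 = ℝʳ` and `v_{,ij}` are the second derivatives of `v` along the dual basis of `𝔱*`. -/
def hessContraction (Ω : KahlerMetric E X) (μ : X → TorusDual r) (v : TorusDual r → ℝ)
    (e : OpenPartialHomeomorph X E) (z : E) : ℝ :=
  ∑ i : Fin r, ∑ j : Fin r,
    fderiv ℝ (fderiv ℝ v) (μ (e.symm z)) (ContinuousLinearMap.proj i) (ContinuousLinearMap.proj j)
      * Ω.loc e z (fundField (Pi.single i (1 : ℝ)) e z) (fundField (Pi.single j (1 : ℝ)) e z)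

/-- The `v`-scalar curvature `Scal_v(Ω) = v(μ) Scal(Ω) + 2 Δ_Ω v(μ) + ⟨g, μ^* Hess v⟩`, in a chart. -/
def weightedScal (Ω : KahlerMetric E X) (μ : X → TorusDual r) (v : TorusDual r → ℝ)
    (e : OpenPartialHomeomorph X E) (z : E) : ℝ :=
  v (μ (e.symm z)) * scalarCurv (Ω.loc e) z
    + 2 * laplacian (Ω.loc e) (fun y => v (μ (e.symm y))) z
    + hessContraction Ω μ v e z

/-- `Ω` is `(v, w)`-cscK: `Scal_v(Ω) = w(μ)`. -/
def IsWeightedCscK (Ω : KahlerMetric E X) (μ : X → TorusDual r) (v w : TorusDual r → ℝ) : Prop :=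
  ∀ e ∈ atlas E X, ∀ z ∈ e.target, weightedScal Ω μ v e z = w (μ (e.symm z))

end WeightedKahler

end

/-!
Let `H` be the hermitian metric on `K_X⁻¹` that normalizes the momentum map, and let the Ricci
potential `κ` be the logarithm of the ratio of `H` and of the metric which `Ω` induces on `K_X⁻¹`;
it is a global function. Put `φ = log v(μ)` and `u = κ - φ`. Both equations say that `u` is
constant.

The Ricci form of a Kähler metric is `-½ ddᶜ log det g` (`IsKahlerOn.ricciForm_eq`) and `Ω` is the
curvature form of `H`, hence `ρ - Ω = ½ ddᶜκ` (`IsKahlerOn.ricciForm_sub_fundForm`), and the soliton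
equation is `ddᶜu = 0`. Taking traces, `Scal = 2m - Δκ` (`IsKahlerOn.scalarCurv_eq`).

The canonical normalization of the momentum map enters through
`Δ⟨μ, ξ⟩ = 2⟨μ, ξ⟩ + ⟨dκ, d⟨μ, ξ⟩⟩` (`IsKahlerOn.laplacian_momentum`): the gradient of `⟨μ, ξ⟩` is
the holomorphic field `-Jξ`; its divergence is the sum of twice the real part of its complex
divergence, which is read off from `ℒ_ξ s = ∇_ξ s + i⟨μ, ξ⟩ s`, and of a derivative of the logarithm
of the volume density. The chain rule for `v(μ)`
then gives `Scal_v - w(μ) = v(μ) (-Δu + ⟨du, dφ⟩)` (`IsKahlerOn.weighted_scalarCurv_sub`).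

If `ddᶜu = 0` then `Δu = 0`, so in either case `u` is in the kernel of an elliptic operator without
zeroth order term on a compact connected manifold, and is constant by Hopf's strong maximum
principle (`eventually_eq_of_drift_laplacian_eq_zero`, `KahlerMetric.exists_eq_const`).

In the charts everything is expressed through real derivatives, and `det g` through the Gram
determinant in a real basis, which is, up to a constant, the square of the complex determinant.
-/

noncomputable section

namespace WeightedKahler

/-! ### Derivatives of smooth maps -/

section Calculus

variable {V F H : Type*} [NormedAddCommGroup V] [NormedSpace ℝ V] [NormedAddCommGroup F]
  [NormedSpace ℝ F] [NormedAddCommGroup H] [NormedSpace ℝ H]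

theorem fderiv_fderiv_symm {f : V → F} {z : V} (hf : ContDiffAt ℝ ∞ f z) (u w : V) :
    fderiv ℝ (fderiv ℝ f) z u w = fderiv ℝ (fderiv ℝ f) z w u :=
  (hf.of_le (m := 2) (WithTop.coe_le_coe.2 le_top)).isSymmSndFDerivAt (by simp) u w

theorem differentiableAt_fderiv {f : V → F} {z : V} (hf : ContDiffAt ℝ ∞ f z) :
    DifferentiableAt ℝ (fderiv ℝ f) z :=
  (hf.fderiv_right (m := 1) (by norm_cast)).differentiableAt (by simp)

theorem fderiv_clm_apply_const {c : V → F →L[ℝ] H} {z : V} (h : DifferentiableAt ℝ c z)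
    (v : V) (u : F) :
    fderiv ℝ (fun x => c x u) z v = fderiv ℝ c z v u := by
  rw [(h.hasFDerivAt.clm_apply (hasFDerivAt_const u z)).fderiv]
  simp

theorem fderiv_clm_apply_const₂ {c : V → V →L[ℝ] F →L[ℝ] H} {z : V}
    (h : DifferentiableAt ℝ c z) (v u : V) (w : F) :
    fderiv ℝ (fun x => c x u w) z v = fderiv ℝ c z v u w := by
  rw [fderiv_clm_apply_const (h.clm_apply (differentiableAt_const u)), fderiv_clm_apply_const h]

theorem eventually_differentiableAt {f : V → F} {z : V} (hf : ContDiffAt ℝ ∞ f z) :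
    ∀ᶠ x in 𝓝 z, DifferentiableAt ℝ f x := by
  filter_upwards [(hf.of_le (m := 1) (WithTop.coe_le_coe.2 le_top)).eventually (by simp)] with x hx
  exact hx.differentiableAt (by simp)

end Calculus

/-! ### Inner products, metric traces and complex structures -/

section LinearAlgebra

/-- A finite-dimensional real vector space with an inner product has an orthonormal basis. (No norm
is assumed on `V`, so that the one defined by the inner product can be used.) -/
theorem exists_orthonormal_basis_of_pos {V : Type*} [AddCommGroup V] [Module ℝ V]
    [FiniteDimensional ℝ V] (g : V → V → ℝ) (hsymm : ∀ u w, g u w = g w u)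
    (hpos : ∀ u, u ≠ 0 → 0 < g u u) (hadd : ∀ u v w, g (u + v) w = g u w + g v w)
    (hsmul : ∀ (c : ℝ) u w, g (c • u) w = c * g u w) :
    ∃ e : Module.Basis (Fin (Module.finrank ℝ V)) ℝ V,
      ∀ i j, g (e i) (e j) = if i = j then 1 else 0 := by
  let core : InnerProductSpace.Core ℝ V :=
    { inner := g
      conj_inner_symm := fun u w => hsymm w u
      re_inner_nonneg := fun u => by
        rcases eq_or_ne u 0 with rfl | h
        · have := hsmul 0 0 0
          simp only [zero_smul, zero_mul] at this
          simp [this]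
        · exact (hpos u h).le
      add_left := hadd
      smul_left := fun u w c => hsmul c u w
      definite := fun u h => by
        by_contra hne
        exact (hpos u hne).ne' h }
  let _ : NormedAddCommGroup V := core.toNormedAddCommGroup
  let _ : InnerProductSpace ℝ V := InnerProductSpace.ofCore core.toCore
  refine ⟨(stdOrthonormalBasis ℝ V).toBasis, fun i j => ?_⟩
  have := orthonormal_iff_ite.mp (stdOrthonormalBasis ℝ V).orthonormal i j
  simp only [OrthonormalBasis.coe_toBasis]
  exact this

variable {V : Type*} [NormedAddCommGroup V] [NormedSpace ℝ V]

/-- The bilinear form `g` is an inner product. -/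
structure IsInnerForm (g : BilForm V) : Prop where
  symm : ∀ u w, g u w = g w u
  pos : ∀ u, u ≠ 0 → 0 < g u u

theorem IsInnerForm.eq_of_forall {g : BilForm V} (hg : IsInnerForm g) {x y : V}
    (h : ∀ w, g x w = g y w) : x = y := by
  by_contra hne
  have h1 := hg.pos (x - y) (sub_ne_zero.mpr hne)
  have h2 := h (x - y)
  simp only [map_sub, _root_.sub_apply] at h1 h2
  linarith

variable [FiniteDimensional ℝ V]

theorem IsInnerForm.isInvertible {g : BilForm V} (hg : IsInnerForm g) :
    (g : V →L[ℝ] (V →L[ℝ] ℝ)).IsInvertible := by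
  have hinj : Function.Injective (g : V →ₗ[ℝ] (V →L[ℝ] ℝ)) := fun x y h =>
    hg.eq_of_forall fun w => congrArg (fun l : V →L[ℝ] ℝ => l w) h
  have hfr : Module.finrank ℝ V = Module.finrank ℝ (V →L[ℝ] ℝ) := by
    rw [← LinearEquiv.finrank_eq (LinearMap.toContinuousLinearMap (𝕜 := ℝ) (E := V) (F' := ℝ))]
    exact (Subspace.dual_finrank_eq (K := ℝ) (V := V)).symm
  refine ⟨(LinearEquiv.ofInjectiveOfFinrankEq (g : V →ₗ[ℝ] (V →L[ℝ] ℝ)) hinj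
    hfr).toContinuousLinearEquiv, ?_⟩
  ext u w
  rfl

theorem IsInnerForm.apply_inverse {g : BilForm V} (hg : IsInnerForm g) (l : V →L[ℝ] ℝ) :
    g (g.inverse l) = l := by
  obtain ⟨M, hM⟩ := hg.isInvertible
  rw [← hM, ContinuousLinearMap.inverse_equiv]
  simp

theorem IsInnerForm.inverse_apply {g : BilForm V} (hg : IsInnerForm g) (u : V) :
    g.inverse (g u) = u := by
  obtain ⟨M, hM⟩ := hg.isInvertible
  rw [← hM, ContinuousLinearMap.inverse_equiv]
  simp

theorem sum_realCoord_smul (u : V) : ∑ a, realCoord a u • Module.finBasis ℝ V a = u :=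
  (Module.finBasis ℝ V).sum_repr u

theorem realTrace_eq_trace (T : V →ₗ[ℝ] V) : realTrace T = LinearMap.trace ℝ V T := by
  rw [LinearMap.trace_eq_matrix_trace ℝ (Module.finBasis ℝ V), Matrix.trace]
  simp [realTrace, realCoord, LinearMap.toMatrix_apply]

/-- A basis that is orthonormal for an inner product `g`. -/
theorem IsInnerForm.exists_orthonormal_basis {g : BilForm V} (hg : IsInnerForm g) :
    ∃ e : Module.Basis (Fin (Module.finrank ℝ V)) ℝ V,
      ∀ i j, g (e i) (e j) = if i = j then 1 else 0 :=
  exists_orthonormal_basis_of_pos (fun u w => g u w) (fun u w => hg.symm u w) hg.pos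
    (fun u v w => by simp) (fun c u w => by simp)

theorem IsInnerForm.inverse_realCoord {g : BilForm V} (hg : IsInnerForm g)
    {e : Module.Basis (Fin (Module.finrank ℝ V)) ℝ V}
    (he : ∀ i j, g (e i) (e j) = if i = j then 1 else 0) (l : V →L[ℝ] ℝ) :
    g.inverse l = ∑ k, l (e k) • e k := by
  have : g (∑ k, l (e k) • e k) = l := by
    have : ((g (∑ k, l (e k) • e k) : V →L[ℝ] ℝ) : V →ₗ[ℝ] ℝ) = (l : V →ₗ[ℝ] ℝ) := by
      refine e.ext fun j => ?_
      simp [he]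
    ext u
    exact congrArg (fun f : V →ₗ[ℝ] ℝ => f u) this
  rw [← this, hg.inverse_apply, this]

/-- The metric trace of a bilinear form is the sum of its diagonal values on an orthonormal
basis. -/
theorem metricTrace_eq_sum {g : BilForm V} (hg : IsInnerForm g)
    {e : Module.Basis (Fin (Module.finrank ℝ V)) ℝ V}
    (he : ∀ i j, g (e i) (e j) = if i = j then 1 else 0) (B : BilForm V) :
    metricTrace g (fun u w => B u w) = ∑ k, B (e k) (e k) := by
  unfold metricTrace
  simp only [hg.inverse_realCoord he, map_sum, map_smul, smul_eq_mul]
  rw [Finset.sum_comm]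
  refine Finset.sum_congr rfl fun k _ => ?_
  have h : B (e k) = ∑ a, realCoord a (e k) • B (Module.finBasis ℝ V a) := by
    conv_lhs => rw [← sum_realCoord_smul (e k)]
    simp only [map_sum, map_smul]
  rw [h]
  simp

theorem metricTrace_add (g : BilForm V) (B C : V → V → ℝ) :
    metricTrace g (fun u w => B u w + C u w) = metricTrace g B + metricTrace g C := by
  simp [metricTrace, Finset.sum_add_distrib]

theorem metricTrace_const_mul (g : BilForm V) (c : ℝ) (B : V → V → ℝ) :
    metricTrace g (fun u w => c * B u w) = c * metricTrace g B := by
  simp [metricTrace, Finset.mul_sum]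

theorem metricTrace_nonpos {g : BilForm V} (hg : IsInnerForm g) (B : BilForm V)
    (hB : ∀ u, B u u ≤ 0) : metricTrace g (fun u w => B u w) ≤ 0 := by
  obtain ⟨e, he⟩ := hg.exists_orthonormal_basis
  rw [metricTrace_eq_sum hg he]
  exact Finset.sum_nonpos fun k _ => hB _

theorem metricTrace_mul_self_pos {g : BilForm V} (hg : IsInnerForm g) {l : V →L[ℝ] ℝ}
    (hl : l ≠ 0) : 0 < metricTrace g (fun u w => l u * l w) := by
  obtain ⟨e, he⟩ := hg.exists_orthonormal_basis
  have h := metricTrace_eq_sum hg he (l.smulRight l)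
  simp only [ContinuousLinearMap.smulRight_apply, _root_.smul_apply,
    smul_eq_mul] at h
  rw [h]
  have hne : ∃ k, l (e k) ≠ 0 := by
    by_contra! hall
    refine hl ?_
    have : (l : V →ₗ[ℝ] ℝ) = 0 := e.ext fun j => by simpa using hall j
    ext u
    exact congrArg (fun f : V →ₗ[ℝ] ℝ => f u) this
  obtain ⟨k, hk⟩ := hne
  exact Finset.sum_pos' (fun j _ => mul_self_nonneg _) ⟨k, Finset.mem_univ _, mul_self_pos.mpr hk⟩

/-- The metric trace may be computed in the image of an orthonormal basis under an isometry. -/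
theorem metricTrace_comp_isometry {g : BilForm V} (hg : IsInnerForm g) (T : V ≃ₗ[ℝ] V)
    (hT : ∀ u w, g (T u) (T w) = g u w) (B : BilForm V) :
    metricTrace g (fun u w => B (T u) (T w)) = metricTrace g (fun u w => B u w) := by
  obtain ⟨e, he⟩ := hg.exists_orthonormal_basis
  have hT' : ∀ i j, g (e.map T i) (e.map T j) = if i = j then 1 else 0 := fun i j => by
    simp [hT, he]
  rw [metricTrace_eq_sum hg hT']
  let T' : V →L[ℝ] V := LinearMap.toContinuousLinearMap (T : V →ₗ[ℝ] V)
  have := metricTrace_eq_sum hg he (B.bilinearComp T' T')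
  simpa [T'] using this

theorem metricTrace_self {g : BilForm V} (hg : IsInnerForm g) :
    metricTrace g (fun u w => g u w) = Module.finrank ℝ V := by
  obtain ⟨e, he⟩ := hg.exists_orthonormal_basis
  rw [metricTrace_eq_sum hg he]
  simp [he]

/-- The metric trace of the bilinear form `g(T·, ·)` is the trace of `T`. -/
theorem metricTrace_comp_left {g : BilForm V} (hg : IsInnerForm g) (T : V → V) :
    metricTrace g (fun u w => g (T u) w) = realTrace T := by
  unfold metricTrace realTrace
  refine Finset.sum_congr rfl fun a _ => ?_
  exact (hg.symm _ _).trans (by rw [hg.apply_inverse])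

theorem metricTrace_mul {g : BilForm V} (hg : IsInnerForm g) (x y : V) :
    metricTrace g (fun u w => g x u * g y w) = g x y := by
  unfold metricTrace
  have : ∀ a, g y (g.inverse (realCoord a)) = realCoord a y := fun a => by
    rw [hg.symm, hg.apply_inverse]
  simp only [this]
  conv_rhs => rw [← sum_realCoord_smul y]
  simp [mul_comm]

end LinearAlgebra

section ComplexStructure

variable {E : Type*} [NormedAddCommGroup E] [NormedSpace ℂ E]

local notation "J" => cplxJ E

theorem cplxJ_apply (u : E) : J u = Complex.I • u := rfl

@[simp] theorem cplxJ_cplxJ (u : E) : J (J u) = -u := by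
  simp [cplxJ_apply, smul_smul]

variable (E) in
/-- Multiplication by `i` as a real-linear automorphism. -/
def cplxJEquiv : E ≃ₗ[ℝ] E :=
  LinearEquiv.ofLinearMap (cplxJ E : E →ₗ[ℝ] E) (-(cplxJ E : E →ₗ[ℝ] E))
    (by ext u; simp) (by ext u; simp)

@[simp] theorem cplxJEquiv_apply (u : E) : cplxJEquiv E u = J u := rfl

variable [FiniteDimensional ℂ E]

/-- A complex antilinear endomorphism has vanishing real trace: conjugation by `J` changes its
sign. -/
theorem realTrace_antilinear (T : E →ₗ[ℝ] E) (hT : ∀ u, T (J u) = -J (T u)) :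
    realTrace T = 0 := by
  rw [realTrace_eq_trace]
  have h1 : LinearMap.trace ℝ E ((cplxJEquiv E).conj T) = LinearMap.trace ℝ E T :=
    LinearMap.trace_conj' T (cplxJEquiv E)
  have h2 : (cplxJEquiv E).conj T = -T := by
    ext u
    rw [LinearEquiv.conj_apply_apply]
    have : (cplxJEquiv E).symm u = -J u := rfl
    simp [this, hT]
  rw [h2, map_neg] at h1
  linarith

/-- The real trace of `-J T`, for a complex linear `T`, is twice the imaginary part of its complex
trace. -/
theorem realTrace_neg_J_comp (T : E →L[ℝ] E) (hT : ∀ u, T (J u) = J (T u)) :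
    realTrace (fun u => -J (T u)) =
      2 * (∑ j, (Module.finBasis ℂ E).coord j (T (stdVec j))).im := by
  let T' : E →ₗ[ℂ] E :=
    { toFun := fun u => T u
      map_add' := fun u w => map_add T u w
      map_smul' := fun c u => by
        have : c • u = c.re • u + c.im • J u := by
          rw [cplxJ_apply]
          conv_lhs => rw [← Complex.re_add_im c, add_smul, mul_smul]
          simp [Complex.coe_smul]
        have h2 : c • T u = c.re • T u + c.im • J (T u) := by
          rw [cplxJ_apply]
          conv_lhs => rw [← Complex.re_add_im c, add_smul, mul_smul]
          simp [Complex.coe_smul]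
        simp [this, h2, hT] }
  let S : E →ₗ[ℝ] E := -((cplxJ E : E →ₗ[ℝ] E) ∘ₗ (T : E →ₗ[ℝ] E))
  have hS : ∀ u, S u = (-Complex.I) • T' u := fun u => by
    simp [S, T', cplxJ_apply]
  change realTrace S = _
  rw [realTrace_eq_trace, LinearMap.trace_eq_matrix_trace ℝ
    (Complex.basisOneI.smulTower (Module.finBasis ℂ E)), Matrix.trace, Fintype.sum_prod_type]
  simp only [Matrix.diag_apply, LinearMap.toMatrix_apply, Module.Basis.smulTower_repr,
    Module.Basis.smulTower_apply, hS, map_smul, Fin.sum_univ_two, Complex.im_sum,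
    Module.Basis.coord_apply]
  rw [← Finset.sum_add_distrib, Finset.mul_sum]
  refine Finset.sum_congr rfl fun j _ => ?_
  have : T' (Module.finBasis ℂ E j) = T (stdVec j) := rfl
  simp [this]
  ring

end ComplexStructure

/-! ### The Levi-Civita connection and the volume density -/

section RiemannianMetric

variable {V : Type*} [NormedAddCommGroup V] [NormedSpace ℝ V]

/-- `G` is a smooth Riemannian metric on the open set `S`. -/
structure IsMetricOn (G : V → BilForm V) (S : Set V) : Prop where
  isOpen : IsOpen S
  smooth : ContDiffOn ℝ ∞ G S
  inner : ∀ z ∈ S, IsInnerForm (G z)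

variable {G : V → BilForm V} {S : Set V} {z : V}

theorem IsMetricOn.contDiffAt (hG : IsMetricOn G S) (hz : z ∈ S) : ContDiffAt ℝ ∞ G z :=
  hG.smooth.contDiffAt (hG.isOpen.mem_nhds hz)

theorem IsMetricOn.differentiableAt (hG : IsMetricOn G S) (hz : z ∈ S) : DifferentiableAt ℝ G z :=
  (hG.contDiffAt hz).differentiableAt (by simp)

theorem IsMetricOn.contDiffOn_fderiv (hG : IsMetricOn G S) : ContDiffOn ℝ ∞ (fderiv ℝ G) S :=
  hG.smooth.fderiv_of_isOpen hG.isOpen (by simp)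

theorem IsMetricOn.fderiv_symm (hG : IsMetricOn G S) (hz : z ∈ S) (v u w : V) :
    fderiv ℝ G z v u w = fderiv ℝ G z v w u := by
  rw [← fderiv_clm_apply_const₂ (hG.differentiableAt hz),
    ← fderiv_clm_apply_const₂ (hG.differentiableAt hz)]
  have : (fun x => G x u w) =ᶠ[𝓝 z] fun x => G x w u := by
    filter_upwards [hG.isOpen.mem_nhds hz] with x hx using (hG.inner x hx).symm u w
  rw [this.fderiv_eq]

theorem IsMetricOn.koszul_contDiffOn (hG : IsMetricOn G S) : ContDiffOn ℝ ∞ (koszul G) S := by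
  have h := hG.contDiffOn_fderiv
  have hflip : ContDiffOn ℝ ∞ (fun z => (fderiv ℝ G z).flip) S :=
    (ContinuousLinearMap.flipₗᵢ ℝ V V (V →L[ℝ] ℝ)).contDiff.comp_contDiffOn h
  refine ContDiffOn.const_smul (1 / 2 : ℝ) ((h.add hflip).sub ?_)
  exact ContDiffOn.clm_comp contDiffOn_const hflip

theorem koszul_symm (hG : IsMetricOn G S) (hz : z ∈ S) (u w : V) :
    koszul G z u w = koszul G z w u := by
  ext y
  rw [koszul_apply, koszul_apply, hG.fderiv_symm hz y u w]
  ring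

theorem christoffel_symm (hG : IsMetricOn G S) (hz : z ∈ S) (u w : V) :
    christoffel G z u w = christoffel G z w u := by
  rw [christoffel_apply, christoffel_apply, koszul_symm hG hz]

/-- Jacobi's formula: the derivative of the determinant at an invertible matrix. -/
theorem hasDerivAt_det_line {n : Type*} [Fintype n] [DecidableEq n] (M N : Matrix n n ℝ)
    (hM : IsUnit M.det) :
    HasDerivAt (fun t : ℝ => (M + t • N).det) (M.det * (M⁻¹ * N).trace) 0 := by
  have h : ∀ t : ℝ, (M + t • N).det = M.det * (1 + t • (M⁻¹ * N)).det := fun t => by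
    rw [← Matrix.det_mul, mul_add, mul_one, mul_smul_comm, ← mul_assoc, Matrix.mul_nonsing_inv _ hM,
      one_mul]
  simp only [h]
  refine HasDerivAt.const_mul _ ?_
  -- `det (1 + t N') = 1 + t tr N' + O(t²)`, with a polynomial remainder
  have h2 := fun t : ℝ => Matrix.det_one_add_smul t (M⁻¹ * N)
  simp only [h2]
  have h3 : HasDerivAt (fun t : ℝ => 1 + (M⁻¹ * N).trace * t) ((M⁻¹ * N).trace) 0 := by
    simpa using ((hasDerivAt_id (0 : ℝ)).const_mul (M⁻¹ * N).trace).const_add 1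
  have h4 := (Polynomial.hasDerivAt
    ((1 + (Polynomial.X : Polynomial ℝ) • (M⁻¹ * N).map Polynomial.C).det.divX.divX) (0 : ℝ)).mul
    (hasDerivAt_pow 2 (0 : ℝ))
  have h5 := h3.add h4
  simp only [ne_eq, OfNat.ofNat_ne_zero, not_false_eq_true, zero_pow, mul_zero, pow_one,
    Nat.add_one_sub_one, add_zero] at h5
  exact h5

theorem contDiff_det {n : Type*} [Fintype n] [DecidableEq n] :
    ContDiff ℝ ∞ (fun M : n → n → ℝ => (Matrix.of M).det) := by
  simp only [Matrix.det_apply]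
  refine ContDiff.sum fun σ _ => ContDiff.const_smul _ (contDiff_prod fun i _ => ?_)
  exact contDiff_apply_apply ℝ ℝ _ _

/-- Transformation of the Gram determinant under a linear map. -/
theorem det_gram_comp {n : Type*} [Fintype n] [DecidableEq n] (g : BilForm V)
    (b : Module.Basis n ℝ V) (T : V →ₗ[ℝ] V) :
    (Matrix.of fun i j => g (T (b i)) (T (b j))).det =
      LinearMap.det T ^ 2 * (Matrix.of fun i j => g (b i) (b j)).det := by
  let B : V →ₗ[ℝ] V →ₗ[ℝ] ℝ := (ContinuousLinearMap.coeLM ℝ).comp (g : V →ₗ[ℝ] (V →L[ℝ] ℝ))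
  have h := LinearMap.toMatrix₂_compl₁₂ b b b b B T T
  have h1 : (Matrix.of fun i j => g (T (b i)) (T (b j))) =
      LinearMap.toMatrix₂ b b (B.compl₁₂ T T) := by
    ext i j; simp [LinearMap.toMatrix₂_apply, B]
  have h2 : (Matrix.of fun i j => g (b i) (b j)) = LinearMap.toMatrix₂ b b B := by
    ext i j; simp [LinearMap.toMatrix₂_apply, B]
  rw [h1, h2, h, Matrix.det_mul, Matrix.det_mul, Matrix.det_transpose, LinearMap.det_toMatrix]
  ring

/-- The derivative of `log det A` is the trace of `A⁻¹ dA`. -/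
theorem fderiv_log_det {n : Type*} [Fintype n] [DecidableEq n] {A : V → n → n → ℝ}
    (hA : DifferentiableAt ℝ A z) (hpos : 0 < (Matrix.of (A z)).det) (w : V) :
    fderiv ℝ (fun x => Real.log (Matrix.of (A x)).det) z w =
      ((Matrix.of (A z))⁻¹ * Matrix.of (fderiv ℝ A z w)).trace := by
  obtain ⟨D, hD⟩ : ∃ D : (n → n → ℝ) → ℝ, D = fun M => (Matrix.of M).det := ⟨_, rfl⟩
  have hdiff : DifferentiableAt ℝ D (A z) := by
    rw [hD]
    exact contDiff_det.differentiable (by simp) _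
  have hDz : (Matrix.of (A z)).det = D (A z) := by rw [hD]
  have hline : fderiv ℝ D (A z) (fderiv ℝ A z w) =
      D (A z) * ((Matrix.of (A z))⁻¹ * Matrix.of (fderiv ℝ A z w)).trace := by
    have h1 := hasDerivAt_det_line (Matrix.of (A z)) (Matrix.of (fderiv ℝ A z w)) hpos.ne'.isUnit
    have h2 : HasDerivAt (fun t : ℝ => A z + t • fderiv ℝ A z w) (fderiv ℝ A z w) 0 := by
      simpa using ((hasDerivAt_id (0 : ℝ)).smul_const (fderiv ℝ A z w)).const_add (A z)
    have h3 : HasFDerivAt D (fderiv ℝ D (A z)) (A z + (0 : ℝ) • fderiv ℝ A z w) := by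
      simpa using hdiff.hasFDerivAt
    have h4 := h3.comp_hasDerivAt 0 h2
    rw [← hDz]
    refine h4.unique (h1.congr_of_eventuallyEq (Filter.Eventually.of_forall fun t => ?_))
    rw [hD]
    rfl
  have hcomp : HasFDerivAt (fun x => D (A x)) ((fderiv ℝ D (A z)).comp (fderiv ℝ A z)) z :=
    hdiff.hasFDerivAt.comp z hA.hasFDerivAt
  have hlog := hcomp.log (hDz ▸ hpos.ne')
  have heq : (fun x => Real.log (Matrix.of (A x)).det) = fun x => Real.log (D (A x)) := by rw [hD]
  rw [heq, hlog.fderiv, _root_.smul_apply, ContinuousLinearMap.comp_apply, hline, smul_eq_mul,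
    ← mul_assoc, inv_mul_cancel₀ (hDz ▸ hpos.ne'), one_mul]

variable [FiniteDimensional ℝ V]

theorem IsMetricOn.inverse_contDiffOn (hG : IsMetricOn G S) :
    ContDiffOn ℝ ∞ (fun z => (G z).inverse) S := fun z hz =>
  ((hG.inner z hz).isInvertible.contDiffAt_map_inverse.comp z (hG.contDiffAt hz)).contDiffWithinAt

theorem IsMetricOn.christoffel_contDiffOn (hG : IsMetricOn G S) :
    ContDiffOn ℝ ∞ (christoffel G) S := by
  have h : ContDiffOn ℝ ∞ (fun z => ContinuousLinearMap.compL ℝ V (V →L[ℝ] ℝ) V (G z).inverse) S :=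
    (ContinuousLinearMap.compL ℝ V (V →L[ℝ] ℝ) V).contDiff.comp_contDiffOn hG.inverse_contDiffOn
  exact h.clm_comp hG.koszul_contDiffOn

theorem IsMetricOn.christoffel_differentiableAt (hG : IsMetricOn G S) (hz : z ∈ S) :
    DifferentiableAt ℝ (christoffel G) z :=
  (hG.christoffel_contDiffOn.contDiffAt (hG.isOpen.mem_nhds hz)).differentiableAt (by simp)

theorem metric_christoffel (hG : IsMetricOn G S) (hz : z ∈ S) (u w y : V) :
    G z (christoffel G z u w) y = koszul G z u w y := by
  rw [christoffel_apply, (hG.inner z hz).apply_inverse]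

/-- The Levi-Civita connection preserves the metric. -/
theorem fderiv_metric (hG : IsMetricOn G S) (hz : z ∈ S) (v u w : V) :
    fderiv ℝ G z v u w = G z (christoffel G z v u) w + G z u (christoffel G z v w) := by
  rw [(hG.inner z hz).symm u, metric_christoffel hG hz, metric_christoffel hG hz, koszul_apply,
    koszul_apply, hG.fderiv_symm hz v w u]
  ring

/-- The logarithm of the Gram determinant of `g` in the standard real basis. -/
def logGramDet (g : BilForm V) : ℝ :=
  Real.log (Matrix.of fun i j => g (Module.finBasis ℝ V i) (Module.finBasis ℝ V j)).det

theorem IsInnerForm.det_gram_pos {g : BilForm V} (hg : IsInnerForm g)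
    (b : Module.Basis (Fin (Module.finrank ℝ V)) ℝ V) :
    0 < (Matrix.of fun i j => g (b i) (b j)).det := by
  obtain ⟨e, he⟩ := hg.exists_orthonormal_basis
  have h := det_gram_comp g e (e.equiv b (Equiv.refl _) : V ≃ₗ[ℝ] V).toLinearMap
  have h1 : (Matrix.of fun i j => g (e i) (e j)) = 1 := by
    ext i j; simp [he, Matrix.one_apply]
  simp only [LinearEquiv.coe_coe, Module.Basis.equiv_apply, Equiv.refl_apply, h1, Matrix.det_one,
    mul_one] at h
  rw [h]
  exact sq_pos_of_ne_zero (LinearEquiv.isUnit_det' _).ne_zero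

theorem logGramDet_contDiffOn (hG : IsMetricOn G S) :
    ContDiffOn ℝ ∞ (fun z => logGramDet (G z)) S := by
  refine ContDiffOn.log ?_ fun z hz => ((hG.inner z hz).det_gram_pos _).ne'
  refine contDiff_det.comp_contDiffOn (f := fun z i j =>
    G z (Module.finBasis ℝ V i) (Module.finBasis ℝ V j)) ?_
  exact contDiffOn_pi.mpr fun i => contDiffOn_pi.mpr fun j =>
    (hG.smooth.clm_apply contDiffOn_const).clm_apply contDiffOn_const

/-- The contracted Christoffel symbols are the logarithmic derivative of the volume density. -/
theorem fderiv_logGramDet (hG : IsMetricOn G S) (hz : z ∈ S) (w : V) :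
    fderiv ℝ (fun x => logGramDet (G x)) z w = 2 * realTrace (fun u => christoffel G z w u) := by
  set b := Module.finBasis ℝ V with hb
  let gram : V → Matrix (Fin (Module.finrank ℝ V)) (Fin (Module.finrank ℝ V)) ℝ :=
    fun x => Matrix.of fun i j => G x (b i) (b j)
  set M := gram z with hM
  let N : Matrix (Fin (Module.finrank ℝ V)) (Fin (Module.finrank ℝ V)) ℝ :=
    Matrix.of fun i j => fderiv ℝ G z w (b i) (b j)
  have hpos : 0 < M.det := (hG.inner z hz).det_gram_pos b
  -- the derivative of the Gram matrix, in terms of the matrix `C` of the Christoffel form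
  let B : V →ₗ[ℝ] V →ₗ[ℝ] ℝ := (ContinuousLinearMap.coeLM ℝ).comp (G z : V →ₗ[ℝ] (V →L[ℝ] ℝ))
  let C := LinearMap.toMatrix b b (christoffel G z w : V →ₗ[ℝ] V)
  have hN : N = C.transpose * M + M * C := by
    have h1 := LinearMap.toMatrix₂_compl₁₂ b b b b B (christoffel G z w : V →ₗ[ℝ] V) LinearMap.id
    have h2 := LinearMap.toMatrix₂_compl₁₂ b b b b B LinearMap.id (christoffel G z w : V →ₗ[ℝ] V)
    have h3 : M = LinearMap.toMatrix₂ b b B := by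
      ext i j; simp [LinearMap.toMatrix₂_apply, B, hM, gram]
    rw [LinearMap.toMatrix_id] at h1 h2
    rw [mul_one] at h1
    rw [Matrix.transpose_one, one_mul] at h2
    rw [h3, ← h1, ← h2]
    ext i j
    simp [N, LinearMap.toMatrix₂_apply, B, fderiv_metric hG hz]
  have htr : (M⁻¹ * N).trace = 2 * realTrace (fun u => christoffel G z w u) := by
    have hC : C.trace = realTrace (fun u => christoffel G z w u) := by
      rw [← LinearMap.trace_eq_matrix_trace]
      exact (realTrace_eq_trace (christoffel G z w : V →ₗ[ℝ] V)).symm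
    have hu : IsUnit M.det := hpos.ne'.isUnit
    rw [hN, mul_add, Matrix.trace_add, Matrix.trace_mul_comm, mul_assoc,
      Matrix.mul_nonsing_inv _ hu, mul_one, ← mul_assoc, Matrix.nonsing_inv_mul _ hu, one_mul, Matrix.trace_transpose, hC]
    ring
  have hgr : ∀ i j, DifferentiableAt ℝ (fun x => G x (b i) (b j)) z := fun i j =>
    ((hG.differentiableAt hz).clm_apply (differentiableAt_const _)).clm_apply
      (differentiableAt_const _)
  have hgr' : DifferentiableAt ℝ (fun x => (fun i j => G x (b i) (b j))) z :=
    differentiableAt_pi.mpr fun i => differentiableAt_pi.mpr fun j => hgr i j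
  have hgrN : fderiv ℝ (fun x => (fun i j => G x (b i) (b j))) z w = N := by
    ext i j
    rw [fderiv_pi fun i => differentiableAt_pi.mpr fun j => hgr i j, ContinuousLinearMap.pi_apply,
      fderiv_pi fun j => hgr i j, ContinuousLinearMap.pi_apply,
      fderiv_clm_apply_const₂ (hG.differentiableAt hz)]
    rfl
  have h := fderiv_log_det hgr' hpos w
  rw [hgrN] at h
  exact h.trans htr

end RiemannianMetric

/-! ### Curvature of Kähler metrics -/

section KahlerMetrics

variable {E : Type*} [NormedAddCommGroup E] [NormedSpace ℂ E]

local notation "J" => cplxJ E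

/-- `G` is a Kähler metric on the open set `S` of the complex vector space `E`. -/
structure IsKahlerOn (G : E → BilForm E) (S : Set E) : Prop extends IsMetricOn G S where
  invJ : ∀ z ∈ S, ∀ u w, G z (J u) (J w) = G z u w
  closed : ∀ z ∈ S, ∀ u v w, extD2 (fundForm G) z u v w = 0

theorem ddc_apply {f : E → ℝ} {z : E} (hf : ContDiffAt ℝ ∞ f z) (u w : E) :
    ddc f z u w = fderiv ℝ (fderiv ℝ f) z w (J u) - fderiv ℝ (fderiv ℝ f) z u (J w) := by
  have h : ∀ u w, fderiv ℝ (dc f) z u w = -fderiv ℝ (fderiv ℝ f) z u (J w) := fun u w => by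
    have h1 : HasFDerivAt (dc f) (-(((ContinuousLinearMap.compL ℝ E E ℝ).flip (cplxJ E)).comp
        (fderiv ℝ (fderiv ℝ f) z))) z :=
      ((((ContinuousLinearMap.compL ℝ E E ℝ).flip (cplxJ E)).hasFDerivAt).comp z
        (differentiableAt_fderiv hf).hasFDerivAt).neg
    rw [h1.fderiv]
    rfl
  rw [ddc, extD1, h, h]
  ring

theorem ddc_sub {f h : E → ℝ} {z : E} (hf : ContDiffAt ℝ ∞ f z) (hh : ContDiffAt ℝ ∞ h z)
    (u w : E) :
    ddc (fun y => f y - h y) z u w = ddc f z u w - ddc h z u w := by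
  have h1 : fderiv ℝ (fun x => f x - h x) =ᶠ[𝓝 z] fun x => fderiv ℝ f x - fderiv ℝ h x := by
    filter_upwards [eventually_differentiableAt hf, eventually_differentiableAt hh] with x hx hx'
    exact fderiv_fun_sub hx hx'
  rw [ddc_apply (hf.sub hh), ddc_apply hf, ddc_apply hh, h1.fderiv_eq,
    fderiv_fun_sub (differentiableAt_fderiv hf) (differentiableAt_fderiv hh)]
  simp only [_root_.sub_apply]
  ring

variable {G : E → BilForm E} {S : Set E} {z : E}

theorem fderiv_fundForm (h : DifferentiableAt ℝ G z) (u v w : E) :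
    fderiv ℝ (fundForm G) z u v w = fderiv ℝ G z u (J v) w := by
  have h1 : HasFDerivAt (fundForm G)
      (((ContinuousLinearMap.compL ℝ E E (E →L[ℝ] ℝ)).flip (cplxJ E)).comp (fderiv ℝ G z)) z :=
    (((ContinuousLinearMap.compL ℝ E E (E →L[ℝ] ℝ)).flip (cplxJ E)).hasFDerivAt).comp z
      h.hasFDerivAt
  rw [h1.fderiv]
  rfl

namespace IsKahlerOn

theorem fderiv_J_J (hG : IsKahlerOn G S) (hz : z ∈ S) (v u w : E) :
    fderiv ℝ G z v (J u) (J w) = fderiv ℝ G z v u w := by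
  rw [← fderiv_clm_apply_const₂ (hG.differentiableAt hz),
    ← fderiv_clm_apply_const₂ (hG.differentiableAt hz)]
  have : (fun x => G x (J u) (J w)) =ᶠ[𝓝 z] fun x => G x u w := by
    filter_upwards [hG.isOpen.mem_nhds hz] with x hx using hG.invJ x hx u w
  rw [this.fderiv_eq]

theorem apply_J_left (hG : IsKahlerOn G S) (hz : z ∈ S) (u w : E) : G z (J u) w = -G z u (J w) := by
  have h := hG.invJ z hz u (J w)
  rw [cplxJ_cplxJ, map_neg] at h
  linarith

theorem fderiv_J_left (hG : IsKahlerOn G S) (hz : z ∈ S) (v u w : E) :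
    fderiv ℝ G z v (J u) w = -fderiv ℝ G z v u (J w) := by
  have h := fderiv_J_J hG hz v u (J w)
  rw [cplxJ_cplxJ, map_neg] at h
  linarith

variable [FiniteDimensional ℂ E]

/-- On a Kähler manifold the complex structure is parallel. -/
theorem christoffel_J_right (hG : IsKahlerOn G S) (hz : z ∈ S) (u w : E) :
    christoffel G z u (J w) = J (christoffel G z u w) := by
  refine (hG.inner z hz).eq_of_forall fun y => ?_
  have hm := hG.toIsMetricOn
  have hd : ∀ a b c : E,
      fderiv ℝ G z a (J b) c - fderiv ℝ G z b (J a) c + fderiv ℝ G z c (J a) b = 0 :=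
    fun a b c => by
      have h := hG.closed z hz a b c
      rw [extD2] at h
      simpa only [fderiv_fundForm (hG.differentiableAt hz)] using h
  rw [apply_J_left hG hz, metric_christoffel hm hz, metric_christoffel hm hz, koszul_apply,
    koszul_apply]
  -- the claim is a combination of `dΩ(u, w, y) = 0` and `dΩ(u, Jw, Jy) = 0`
  have h1 := hd u w y
  rw [fderiv_J_left hG hz w u y, fderiv_J_left hG hz y u w] at h1
  have h2 := hd u (J w) (J y)
  rw [cplxJ_cplxJ, fderiv_J_J hG hz, fderiv_J_J hG hz] at h2
  simp only [map_neg, _root_.neg_apply] at h2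
  have h3 := fderiv_J_left hG hz u w y
  linarith

theorem christoffel_J_left (hG : IsKahlerOn G S) (hz : z ∈ S) (u w : E) :
    christoffel G z (J u) w = J (christoffel G z u w) := by
  have hm := hG.toIsMetricOn
  rw [christoffel_symm hm hz, christoffel_J_right hG hz, christoffel_symm hm hz]

/-- The Levi-Civita connection of a Kähler metric is its Chern connection:
`2 g(Γ(v, w), y) = ∂_v g(w, y) - ∂_{Jv} g(Jw, y)`. -/
theorem metric_christoffel_eq (hG : IsKahlerOn G S) (hz : z ∈ S) (v w y : E) :
    G z (christoffel G z v w) y =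
      1 / 2 * (fderiv ℝ G z v w y - fderiv ℝ G z (J v) (J w) y) := by
  have hm := hG.toIsMetricOn
  rw [fderiv_metric hm hz, fderiv_metric hm hz, christoffel_J_left hG hz, christoffel_J_left hG hz,
    christoffel_J_right hG hz, cplxJ_cplxJ, hG.invJ z hz, map_neg, _root_.neg_apply]
  ring

theorem fderiv_christoffel_J_right (hG : IsKahlerOn G S) (hz : z ∈ S) (u v w : E) :
    fderiv ℝ (christoffel G) z u v (J w) = J (fderiv ℝ (christoffel G) z u v w) := by
  have hd := hG.toIsMetricOn.christoffel_differentiableAt hz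
  rw [← fderiv_clm_apply_const₂ hd]
  have h : (fun x => christoffel G x v (J w)) =ᶠ[𝓝 z] fun x => J (christoffel G x v w) := by
    filter_upwards [hG.isOpen.mem_nhds hz] with x hx using christoffel_J_right hG hx v w
  have h2 : DifferentiableAt ℝ (fun x => christoffel G x v w) z :=
    (hd.clm_apply (differentiableAt_const v)).clm_apply (differentiableAt_const w)
  have h3 : HasFDerivAt (fun x => J (christoffel G x v w)) _ z :=
    (cplxJ E).hasFDerivAt.comp z h2.hasFDerivAt
  rw [h.fderiv_eq, h3.fderiv, ContinuousLinearMap.comp_apply, fderiv_clm_apply_const₂ hd]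

theorem fderiv_christoffel_symm (hG : IsKahlerOn G S) (hz : z ∈ S) (u v w : E) :
    fderiv ℝ (christoffel G) z u v w = fderiv ℝ (christoffel G) z u w v := by
  have hd := hG.toIsMetricOn.christoffel_differentiableAt hz
  rw [← fderiv_clm_apply_const₂ hd, ← fderiv_clm_apply_const₂ hd]
  have h : (fun x => christoffel G x v w) =ᶠ[𝓝 z] fun x => christoffel G x w v := by
    filter_upwards [hG.isOpen.mem_nhds hz] with x hx using christoffel_symm hG.toIsMetricOn hx v w
  rw [h.fderiv_eq]

theorem fderiv_christoffel_J_left (hG : IsKahlerOn G S) (hz : z ∈ S) (u v w : E) :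
    fderiv ℝ (christoffel G) z u (J v) w = J (fderiv ℝ (christoffel G) z u v w) := by
  rw [fderiv_christoffel_symm hG hz, fderiv_christoffel_J_right hG hz,
    fderiv_christoffel_symm hG hz]

/-- The terms `∂_u Γ(v, w) + Γ(u, Γ(v, w))` of the curvature, from the derivative of
`metric_christoffel_eq`. -/
theorem metric_fderiv_christoffel (hG : IsKahlerOn G S) (hz : z ∈ S) (u v w y : E) :
    G z (fderiv ℝ (christoffel G) z u v w + christoffel G z u (christoffel G z v w)) y =
      1 / 2 * (fderiv ℝ (fderiv ℝ G) z u v w y - fderiv ℝ (fderiv ℝ G) z u (J v) (J w) y)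
        - G z (christoffel G z v w) (christoffel G z u y) := by
  have hm := hG.toIsMetricOn
  have hd := hm.christoffel_differentiableAt hz
  have hd2 := differentiableAt_fderiv (hm.contDiffAt hz)
  have hc : DifferentiableAt ℝ (fun x => christoffel G x v w) z :=
    (hd.clm_apply (differentiableAt_const v)).clm_apply (differentiableAt_const w)
  have h : (fun x => G x (christoffel G x v w) y) =ᶠ[𝓝 z]
      fun x => 1 / 2 * (fderiv ℝ G x v w y - fderiv ℝ G x (J v) (J w) y) := by
    filter_upwards [hG.isOpen.mem_nhds hz] with x hx using metric_christoffel_eq hG hx v w y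
  have hl : fderiv ℝ (fun x => G x (christoffel G x v w) y) z u =
      G z (fderiv ℝ (christoffel G) z u v w) y + fderiv ℝ G z u (christoffel G z v w) y := by
    have h1 := ((hm.differentiableAt hz).hasFDerivAt.clm_apply hc.hasFDerivAt).clm_apply
      (hasFDerivAt_const y z)
    rw [h1.fderiv]
    simp [fderiv_clm_apply_const₂ hd]
  have hr : ∀ v w : E, HasFDerivAt (fun x => fderiv ℝ G x v w y)
      (((fderiv ℝ (fderiv ℝ G) z).flip v).flip w |>.flip y) z := fun v w => by
    have h1 := ((hd2.hasFDerivAt.clm_apply (hasFDerivAt_const v z)).clm_apply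
      (hasFDerivAt_const w z)).clm_apply (hasFDerivAt_const y z)
    refine h1.congr_fderiv ?_
    ext u
    simp
  rw [h.fderiv_eq, (((hr v w).fun_sub (hr (J v) (J w))).const_mul (1 / 2 : ℝ)).fderiv,
    fderiv_metric hm hz] at hl
  simp only [_root_.smul_apply, _root_.sub_apply, ContinuousLinearMap.flip_apply, smul_eq_mul] at hl
  rw [map_add, _root_.add_apply]
  linarith

/-- The curvature of a Kähler metric is of type `(1,1)`. -/
theorem riemann_J_J (hG : IsKahlerOn G S) (hz : z ∈ S) (u v w : E) :
    riemann G z (J u) (J v) w = riemann G z u v w := by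
  have hm := hG.toIsMetricOn
  refine (hG.inner z hz).eq_of_forall fun y => ?_
  have key : ∀ u v, G z (riemann G z u v w) y =
      G z (fderiv ℝ (christoffel G) z u v w + christoffel G z u (christoffel G z v w)) y
      - G z (fderiv ℝ (christoffel G) z v u w + christoffel G z v (christoffel G z u w)) y :=
    fun u v => by
      rw [riemann]
      simp only [map_add, map_sub, _root_.add_apply, _root_.sub_apply]
      ring
  rw [key, key]
  simp only [metric_fderiv_christoffel hG hz]
  have s := fun a b => fderiv_fderiv_symm (hm.contDiffAt hz) a b
  simp only [christoffel_J_left hG hz, hG.invJ z hz, cplxJ_cplxJ, map_neg, _root_.neg_apply]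
  rw [s (J u) (J v), s u v, s u (J v), s v (J u)]
  ring

/-- The Ricci tensor of a Kähler metric, as second derivatives of the logarithm of the real Gram
determinant. Averaging `R(u, v)` with `R(Ju, Jv)` removes the quadratic terms in the Christoffel
symbols; of the rest, the part antilinear in `u` has no trace, and the other part has the derivative
of the contracted Christoffel symbols as trace. -/
theorem ricciTensor_eq (hG : IsKahlerOn G S) (hz : z ∈ S) (v w : E) :
    ricciTensor G z v w = -(1 / 4) * (fderiv ℝ (fderiv ℝ fun x => logGramDet (G x)) z v w
      + fderiv ℝ (fderiv ℝ fun x => logGramDet (G x)) z (J v) (J w)) := by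
  have hm := hG.toIsMetricOn
  set A := fderiv ℝ (christoffel G) z with hA
  have hd := hm.christoffel_differentiableAt hz
  have hLd := differentiableAt_fderiv
    ((logGramDet_contDiffOn hm).contDiffAt (hG.isOpen.mem_nhds hz))
  have hL : ∀ v w, fderiv ℝ (fderiv ℝ fun x => logGramDet (G x)) z v w =
      2 * realTrace (fun u => A v w u) := fun v w => by
    rw [← fderiv_clm_apply_const hLd]
    have h : (fun x => fderiv ℝ (fun x => logGramDet (G x)) x w) =ᶠ[𝓝 z]
        fun x => 2 * realTrace (fun u => christoffel G x w u) := by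
      filter_upwards [hG.isOpen.mem_nhds hz] with x hx using fderiv_logGramDet hm hx w
    rw [h.fderiv_eq]
    have h1 : ∀ a, HasFDerivAt (fun x => realCoord a (christoffel G x w (Module.finBasis ℝ E a)))
        ((realCoord a).comp ((A.flip w).flip (Module.finBasis ℝ E a))) z := fun a => by
      have h2 := (hd.hasFDerivAt.clm_apply (hasFDerivAt_const w z)).clm_apply
        (hasFDerivAt_const (Module.finBasis ℝ E a) z)
      refine ((realCoord a).hasFDerivAt.comp z h2).congr_fderiv ?_
      ext u
      simp [hA]
    have h3 := (HasFDerivAt.fun_sum fun a (_ : a ∈ Finset.univ) => h1 a).const_mul (2 : ℝ)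
    unfold realTrace
    rw [h3.fderiv]
    simp
  have hR : ∀ u, riemann G z u v w = (1 / 2 : ℝ) • ((A u v w + J (A (J u) v w))
      - A v w u - A (J v) (J w) u) := fun u => by
    have h1 : (2 : ℝ) • riemann G z u v w = riemann G z u v w + riemann G z (J u) (J v) w := by
      rw [riemann_J_J hG hz, two_smul]
    have h2 : (2 : ℝ) • riemann G z u v w = (A u v w + J (A (J u) v w))
        - A v w u - A (J v) (J w) u := by
      rw [h1, riemann, riemann]
      simp only [← hA, christoffel_J_left hG hz, christoffel_J_right hG hz, cplxJ_cplxJ]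
      simp only [hA, fderiv_christoffel_J_left hG hz, fderiv_christoffel_symm hG hz v w u,
        fderiv_christoffel_symm hG hz (J v) w u]
      abel
    rw [← h2, smul_smul]
    norm_num
  have h0 : realTrace (fun u => A u v w + J (A (J u) v w)) = 0 := by
    let T : E →L[ℝ] E := (A.flip v).flip w + (cplxJ E).comp (((A.flip v).flip w).comp (cplxJ E))
    exact realTrace_antilinear (T : E →ₗ[ℝ] E) fun u => by
      simp [T]
  have hsum : ricciTensor G z v w = 1 / 2 * (realTrace (fun u => A u v w + J (A (J u) v w))
      - realTrace (fun u => A v w u) - realTrace (fun u => A (J v) (J w) u)) := by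
    rw [ricciTensor]
    simp only [hR, realTrace, map_smul, map_sub, smul_eq_mul, Finset.mul_sum,
      ← Finset.sum_sub_distrib]
  rw [hsum, h0, hL, hL]
  ring

/-- `ρ = -¼ ddᶜ log det_ℝ g`; up to a constant, the real determinant is the square of the complex
one. -/
theorem ricciForm_eq (hG : IsKahlerOn G S) (hz : z ∈ S) (u w : E) :
    ricciForm G z u w = -(1 / 4) * ddc (fun x => logGramDet (G x)) z u w := by
  have hL := (logGramDet_contDiffOn hG.toIsMetricOn).contDiffAt (hG.isOpen.mem_nhds hz)
  rw [ricciForm, ricciTensor_eq hG hz, ddc_apply hL, cplxJ_cplxJ, fderiv_fderiv_symm hL w]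
  simp only [map_neg, _root_.neg_apply]
  ring

/-- The metric trace of the Hessian only involves the `J`-invariant part of the second
derivative. -/
theorem metricTrace_hessian (hG : IsKahlerOn G S) (hz : z ∈ S) (f : E → ℝ) :
    metricTrace (G z) (fun u w => fderiv ℝ (fderiv ℝ f) z u w + fderiv ℝ (fderiv ℝ f) z (J u) (J w))
      = -2 * laplacian G f z := by
  let B : BilForm E := fderiv ℝ (fderiv ℝ f) z -
    (ContinuousLinearMap.compL ℝ E E ℝ (fderiv ℝ f z)).comp (christoffel G z)
  have hB : ∀ u w, B u w = hessian G f z u w := fun u w => rfl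
  have h1 := metricTrace_comp_isometry (hG.inner z hz) (cplxJEquiv E) (hG.invJ z hz) B
  have h2 : ∀ u w, fderiv ℝ (fderiv ℝ f) z u w + fderiv ℝ (fderiv ℝ f) z (J u) (J w) =
      B u w + B (J u) (J w) := fun u w => by
    simp only [hB, hessian, christoffel_J_left hG hz, christoffel_J_right hG hz, cplxJ_cplxJ,
      map_neg]
    ring
  simp only [h2]
  simp only [cplxJEquiv_apply] at h1
  have h3 : metricTrace (G z) (fun u w => B u w) = metricTrace (G z) (hessian G f z) := rfl
  rw [metricTrace_add, h1, h3, laplacian]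
  ring

end IsKahlerOn

end KahlerMetrics

/-! ### The Laplacian -/

section Laplacian

variable {V : Type*} [NormedAddCommGroup V] [NormedSpace ℝ V]
  {G : V → BilForm V} {S : Set V} {z : V}

theorem fderiv_exp_comp {f : V → ℝ} (hf : DifferentiableAt ℝ f z) (u : V) :
    fderiv ℝ (fun x => Real.exp (f x)) z u = Real.exp (f z) * fderiv ℝ f z u := by
  rw [fderiv_exp hf]; simp

variable [FiniteDimensional ℝ V]

/-- The inner product of the differentials of two functions. -/
def gradInner (G : V → BilForm V) (f h : V → ℝ) (z : V) : ℝ :=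
  metricTrace (G z) fun u w => fderiv ℝ f z u * fderiv ℝ h z w

theorem laplacian_congr {f h : V → ℝ} (hfh : f =ᶠ[𝓝 z] h) : laplacian G f z = laplacian G h z := by
  unfold laplacian hessian
  rw [hfh.fderiv_eq, hfh.fderiv.fderiv_eq]

theorem gradInner_congr_left {f h φ : V → ℝ} (hfh : f =ᶠ[𝓝 z] h) :
    gradInner G f φ z = gradInner G h φ z := by
  unfold gradInner
  rw [hfh.fderiv_eq]

theorem laplacian_add {f h : V → ℝ} (hf : ContDiffAt ℝ ∞ f z) (hh : ContDiffAt ℝ ∞ h z) :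
    laplacian G (fun x => f x + h x) z = laplacian G f z + laplacian G h z := by
  have h1 : fderiv ℝ (fun x => f x + h x) =ᶠ[𝓝 z] fun x => fderiv ℝ f x + fderiv ℝ h x := by
    filter_upwards [eventually_differentiableAt hf, eventually_differentiableAt hh] with x hx hx'
    exact fderiv_fun_add hx hx'
  have h2 : ∀ u w, hessian G (fun x => f x + h x) z u w =
      hessian G f z u w + hessian G h z u w := by
    intro u w
    unfold hessian
    rw [h1.fderiv_eq, h1.eq_of_nhds, fderiv_fun_add (differentiableAt_fderiv hf)
      (differentiableAt_fderiv hh)]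
    simp only [_root_.add_apply]
    ring
  rw [laplacian, laplacian, laplacian, ← neg_add, ← metricTrace_add]
  congr 2
  ext u w
  exact h2 u w

theorem laplacian_const_mul {f : V → ℝ} (c : ℝ) :
    laplacian G (fun x => c * f x) z = c * laplacian G f z := by
  have h2 : ∀ u w, hessian G (fun x => c * f x) z u w = c * hessian G f z u w := by
    intro u w
    have h1 : (fun x => c * f x) = c • f := rfl
    unfold hessian
    rw [h1, fderiv_const_smul_field, fderiv_const_smul_field]
    simp only [_root_.smul_apply, Pi.smul_apply, smul_eq_mul]
    ring
  rw [laplacian, laplacian, mul_neg, ← metricTrace_const_mul]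
  congr 2
  ext u w
  exact h2 u w

theorem gradInner_add_left {f h k : V → ℝ} (hf : DifferentiableAt ℝ f z)
    (hh : DifferentiableAt ℝ h z) :
    gradInner G (fun x => f x + h x) k z = gradInner G f k z + gradInner G h k z := by
  rw [gradInner, gradInner, gradInner, ← metricTrace_add]
  congr 1
  ext u w
  rw [fderiv_fun_add hf hh, _root_.add_apply]
  ring

theorem gradInner_const_mul_left {f h : V → ℝ} (c : ℝ) :
    gradInner G (fun x => c * f x) h z = c * gradInner G f h z := by
  rw [gradInner, gradInner, ← metricTrace_const_mul]
  congr 1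
  ext u w
  have h1 : (fun x => c * f x) = c • f := rfl
  rw [h1, fderiv_const_smul_field]
  simp only [_root_.smul_apply, Pi.smul_apply, smul_eq_mul]
  ring

/-- If `y` is the gradient of `h`, then `⟨df, dh⟩` is the derivative of `f` along `y`. -/
theorem gradInner_eq_of_right (hg : IsInnerForm (G z)) {f h : V → ℝ} {y : V}
    (hh : ∀ u, fderiv ℝ h z u = G z y u) : gradInner G f h z = fderiv ℝ f z y := by
  have h1 : ∀ u, fderiv ℝ f z u = G z ((G z).inverse (fderiv ℝ f z)) u := fun u => by
    rw [hg.apply_inverse]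
  unfold gradInner
  simp only [hh]
  simp only [h1, metricTrace_mul hg]

theorem gradInner_symm (hg : IsInnerForm (G z)) (f h : V → ℝ) :
    gradInner G f h z = gradInner G h f z := by
  have h1 : ∀ (f : V → ℝ) u, fderiv ℝ f z u = G z ((G z).inverse (fderiv ℝ f z)) u := fun f u => by
    rw [hg.apply_inverse]
  rw [gradInner_eq_of_right hg (h1 h), h1, hg.symm, ← h1, gradInner_eq_of_right hg (h1 f)]

theorem gradInner_self_pos (hg : IsInnerForm (G z)) {f : V → ℝ} (hf : fderiv ℝ f z ≠ 0) :
    0 < gradInner G f f z := metricTrace_mul_self_pos hg hf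

theorem gradInner_exp_left {f h : V → ℝ} (hf : DifferentiableAt ℝ f z) :
    gradInner G (fun x => Real.exp (f x)) h z = Real.exp (f z) * gradInner G f h z := by
  rw [gradInner, gradInner, ← metricTrace_const_mul]
  congr 1
  ext u w
  rw [fderiv_exp_comp hf]
  ring

theorem laplacian_exp {f : V → ℝ} (hf : ContDiffAt ℝ ∞ f z) :
    laplacian G (fun x => Real.exp (f x)) z
      = Real.exp (f z) * (laplacian G f z - gradInner G f f z) := by
  have hd := hf.differentiableAt (by simp)
  have h1 : fderiv ℝ (fun x => Real.exp (f x)) =ᶠ[𝓝 z] fun x => Real.exp (f x) • fderiv ℝ f x := by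
    filter_upwards [eventually_differentiableAt hf] with x hx using fderiv_exp hx
  have h2 : ∀ u w, hessian G (fun x => Real.exp (f x)) z u w =
      Real.exp (f z) * (hessian G f z u w + fderiv ℝ f z u * fderiv ℝ f z w) := by
    intro u w
    unfold hessian
    rw [h1.fderiv_eq, h1.eq_of_nhds, fderiv_fun_smul hd.exp (differentiableAt_fderiv hf)]
    simp only [_root_.add_apply, _root_.smul_apply, ContinuousLinearMap.smulRight_apply,
      fderiv_exp_comp hd, smul_eq_mul]
    ring
  have h3 : laplacian G (fun x => Real.exp (f x)) z =
      -metricTrace (G z) fun u w =>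
        Real.exp (f z) * (hessian G f z u w + fderiv ℝ f z u * fderiv ℝ f z w) := by
    rw [laplacian]
    congr 2
    ext u w
    exact h2 u w
  rw [h3, metricTrace_const_mul, metricTrace_add, laplacian, gradInner]
  ring

/-- Chain rule for the Laplacian of a function of several functions `c i`, with first and second
partial derivatives `p i` and `q j i`. -/
theorem laplacian_of_fderiv_eq_sum {ι : Type*} [Fintype ι] {f : V → ℝ} {c : ι → V → ℝ}
    {p : ι → V → ℝ} {q : ι → ι → ℝ} (hc : ∀ i, ContDiffAt ℝ ∞ (c i) z)
    (hp : ∀ i, DifferentiableAt ℝ (p i) z)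
    (hf : ∀ᶠ x in 𝓝 z, fderiv ℝ f x = ∑ i, p i x • fderiv ℝ (c i) x)
    (hq : ∀ i u, fderiv ℝ (p i) z u = ∑ j, q j i * fderiv ℝ (c j) z u) :
    laplacian G f z = ∑ i, p i z * laplacian G (c i) z
      - ∑ j, ∑ i, q j i * gradInner G (c j) (c i) z := by
  have hsum : fderiv ℝ (fun x => ∑ i, p i x • fderiv ℝ (c i) x) z =
      ∑ i, (p i z • fderiv ℝ (fderiv ℝ (c i)) z
        + (fderiv ℝ (p i) z).smulRight (fderiv ℝ (c i) z)) := by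
    rw [fderiv_fun_sum fun i _ => (hp i).fun_smul (differentiableAt_fderiv (hc i))]
    exact Finset.sum_congr rfl fun i _ => fderiv_fun_smul (hp i) (differentiableAt_fderiv (hc i))
  have h2 : ∀ u w, hessian G f z u w = (∑ i, p i z * hessian G (c i) z u w) +
      ∑ j, ∑ i, q j i * (fderiv ℝ (c j) z u * fderiv ℝ (c i) z w) := by
    intro u w
    have hf' : fderiv ℝ f =ᶠ[𝓝 z] fun x => ∑ i, p i x • fderiv ℝ (c i) x := hf
    unfold hessian
    rw [hf'.fderiv_eq, hf'.eq_of_nhds, hsum]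
    simp only [_root_.sum_apply, _root_.add_apply, _root_.smul_apply,
      ContinuousLinearMap.smulRight_apply, smul_eq_mul, hq]
    rw [Finset.sum_add_distrib, Finset.sum_comm (γ := ι) (f := fun j i => q j i * _)]
    simp only [mul_sub, Finset.sum_sub_distrib, Finset.sum_mul, mul_assoc]
    ring
  have h3 : metricTrace (G z) (hessian G f z) =
      (∑ i, p i z * metricTrace (G z) (hessian G (c i) z))
        + ∑ j, ∑ i, q j i * gradInner G (c j) (c i) z := by
    unfold gradInner metricTrace
    simp only [h2, Finset.sum_add_distrib, Finset.mul_sum]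
    congr 1
    · rw [Finset.sum_comm]
    · rw [Finset.sum_comm]
      refine Finset.sum_congr rfl fun j _ => ?_
      rw [Finset.sum_comm]
  rw [laplacian, h3]
  simp only [laplacian, mul_neg, Finset.sum_neg_distrib]
  ring

/-- The Laplacian of a function whose gradient is the vector field `Y`, as minus the divergence of
`Y`. -/
theorem laplacian_eq_of_gradient (hG : IsMetricOn G S) (hz : z ∈ S) {f : V → ℝ} {Y : V → V}
    (hf : ∀ x ∈ S, ∀ u, fderiv ℝ f x u = G x (Y x) u) (hY : DifferentiableAt ℝ Y z)
    (hfs : ContDiffAt ℝ ∞ f z) :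
    laplacian G f z = -realTrace (fun u => fderiv ℝ Y z u)
      - 1 / 2 * fderiv ℝ (fun x => logGramDet (G x)) z (Y z) := by
  have h1 : ∀ u w, hessian G f z u w =
      G z (christoffel G z (Y z) u + fderiv ℝ Y z u) w := fun u w => by
    have h2 : (fun x => fderiv ℝ f x w) =ᶠ[𝓝 z] fun x => G x (Y x) w := by
      filter_upwards [hG.isOpen.mem_nhds hz] with x hx using hf x hx w
    have h3 := ((hG.differentiableAt hz).hasFDerivAt.clm_apply hY.hasFDerivAt).clm_apply
      (hasFDerivAt_const w z)
    have h4 : fderiv ℝ (fun x => fderiv ℝ f x w) z u =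
        G z (fderiv ℝ Y z u) w + fderiv ℝ G z u (Y z) w := by
      rw [h2.fderiv_eq, h3.fderiv]
      simp
    rw [fderiv_clm_apply_const (differentiableAt_fderiv hfs)] at h4
    rw [hessian, h4, hf z hz, fderiv_metric hG hz, christoffel_symm hG hz (Y z), map_add,
      _root_.add_apply]
    ring
  have h5 : metricTrace (G z) (hessian G f z) =
      metricTrace (G z) fun u w => G z (christoffel G z (Y z) u + fderiv ℝ Y z u) w := by
    congr 1
    ext u w
    exact h1 u w
  rw [laplacian, h5, metricTrace_comp_left (hG.inner z hz), fderiv_logGramDet hG hz]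
  simp only [realTrace, map_add, Finset.sum_add_distrib]
  ring

end Laplacian

/-! ### The Ricci potential and the momenta -/

section RicciPotential

variable {E : Type*} [NormedAddCommGroup E] [NormedSpace ℂ E] [FiniteDimensional ℂ E]
  {G : E → BilForm E} {S : Set E} {z : E}

local notation "J" => cplxJ E

/-- The Ricci potential `log (|∂₁ ∧ ⋯ ∧ ∂ₘ|² / det g)` of a metric whose fundamental form is
`-½ ddᶜψ`, with `ψ = log |∂₁ ∧ ⋯ ∧ ∂ₘ|²`. Up to a constant, which does not matter, the real Gram
determinant is the square of the complex one. -/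
def ricciPotential (G : E → BilForm E) (ψ : E → ℝ) (z : E) : ℝ :=
  ψ z - 1 / 2 * logGramDet (G z)

theorem ricciPotential_contDiffOn (hG : IsMetricOn G S) {ψ : E → ℝ} (hψ : ContDiffOn ℝ ∞ ψ S) :
    ContDiffOn ℝ ∞ (ricciPotential G ψ) S :=
  hψ.sub (contDiffOn_const.mul (logGramDet_contDiffOn hG))

theorem fderiv_ricciPotential (hG : IsMetricOn G S) {ψ : E → ℝ} (hψ : ContDiffOn ℝ ∞ ψ S)
    (hz : z ∈ S) (u : E) : fderiv ℝ (ricciPotential G ψ) z u =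
      fderiv ℝ ψ z u - 1 / 2 * fderiv ℝ (fun x => logGramDet (G x)) z u := by
  have h1 := (hψ.contDiffAt (hG.isOpen.mem_nhds hz)).differentiableAt (by simp)
  have h2 := ((logGramDet_contDiffOn hG).contDiffAt (hG.isOpen.mem_nhds hz)).differentiableAt
    (by simp)
  have h3 : HasFDerivAt (ricciPotential G ψ) _ z :=
    h1.hasFDerivAt.fun_sub (h2.hasFDerivAt.const_mul (1 / 2))
  rw [h3.fderiv]
  simp

theorem fderiv_fderiv_ricciPotential (hG : IsMetricOn G S) {ψ : E → ℝ} (hψ : ContDiffOn ℝ ∞ ψ S)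
    (hz : z ∈ S) (u w : E) : fderiv ℝ (fderiv ℝ (ricciPotential G ψ)) z u w =
      fderiv ℝ (fderiv ℝ ψ) z u w
        - 1 / 2 * fderiv ℝ (fderiv ℝ (fun x => logGramDet (G x))) z u w := by
  have hS := hG.isOpen.mem_nhds hz
  have h1 := differentiableAt_fderiv (hψ.contDiffAt hS)
  have h2 := differentiableAt_fderiv ((logGramDet_contDiffOn hG).contDiffAt hS)
  have h3 : HasFDerivAt
      (fun x => fderiv ℝ ψ x - (1 / 2 : ℝ) • fderiv ℝ (fun x => logGramDet (G x)) x) _ z :=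
    h1.hasFDerivAt.fun_sub (h2.hasFDerivAt.fun_const_smul (1 / 2))
  have h4 : fderiv ℝ (ricciPotential G ψ) =ᶠ[𝓝 z]
      fun x => fderiv ℝ ψ x - (1 / 2 : ℝ) • fderiv ℝ (fun x => logGramDet (G x)) x := by
    filter_upwards [hS] with x hx
    ext u
    simp [fderiv_ricciPotential hG hψ hx]
  rw [h4.fderiv_eq, h3.fderiv]
  simp

namespace IsKahlerOn

/-- `ρ - Ω = ½ ddᶜκ`, for the Ricci potential `κ`. -/
theorem ricciForm_sub_fundForm (hG : IsKahlerOn G S) {ψ : E → ℝ} (hψ : ContDiffOn ℝ ∞ ψ S)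
    (hcurv : ∀ z ∈ S, ∀ u w, fundForm G z u w = -(1 / 2) * ddc ψ z u w) (hz : z ∈ S)
    (u w : E) :
    ricciForm G z u w - fundForm G z u w = 1 / 2 * ddc (ricciPotential G ψ) z u w := by
  have hS := hG.isOpen.mem_nhds hz
  rw [hG.ricciForm_eq hz, hcurv z hz, ddc_apply (hψ.contDiffAt hS),
    ddc_apply ((logGramDet_contDiffOn hG.toIsMetricOn).contDiffAt hS),
    ddc_apply ((ricciPotential_contDiffOn hG.toIsMetricOn hψ).contDiffAt hS)]
  simp only [fderiv_fderiv_ricciPotential hG.toIsMetricOn hψ hz]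
  ring

/-- The trace of `ρ - Ω = ½ ddᶜκ`. -/
theorem scalarCurv_eq (hG : IsKahlerOn G S) {ψ : E → ℝ} (hψ : ContDiffOn ℝ ∞ ψ S)
    (hcurv : ∀ z ∈ S, ∀ u w, fundForm G z u w = -(1 / 2) * ddc ψ z u w) (hz : z ∈ S) :
    scalarCurv G z = 2 * Module.finrank ℂ E - laplacian G (ricciPotential G ψ) z := by
  have hS := hG.isOpen.mem_nhds hz
  have hm := hG.toIsMetricOn
  have h1 : ∀ u w, ricciTensor G z u w = G z u w + 1 / 2 *
      (fderiv ℝ (fderiv ℝ (ricciPotential G ψ)) z u w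
        + fderiv ℝ (fderiv ℝ (ricciPotential G ψ)) z (J u) (J w)) := fun u w => by
    have h2 := hcurv z hz (J u) w
    have h3 : fundForm G z (J u) w = -G z u w := by simp [fundForm]
    rw [h3, ddc_apply (hψ.contDiffAt hS), cplxJ_cplxJ,
      fderiv_fderiv_symm (hψ.contDiffAt hS) w, map_neg, _root_.neg_apply] at h2
    rw [hG.ricciTensor_eq hz]
    simp only [fderiv_fderiv_ricciPotential hm hψ hz]
    linarith
  have h4 : scalarCurv G z = metricTrace (G z) fun u w => G z u w + 1 / 2 *
      (fderiv ℝ (fderiv ℝ (ricciPotential G ψ)) z u w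
        + fderiv ℝ (fderiv ℝ (ricciPotential G ψ)) z (J u) (J w)) := by
    rw [scalarCurv]
    congr 1
    ext u w
    exact h1 u w
  rw [h4, metricTrace_add, metricTrace_self (hG.inner z hz), metricTrace_const_mul,
    hG.metricTrace_hessian hz, finrank_real_of_complex]
  push_cast
  ring

/-- The Laplacian of a canonically normalized momentum: if `f` is a Hamiltonian of the holomorphic
field `ξ` and `ℒ_ξ s = ∇_ξ s + i f s` on `K_X⁻¹`, then `Δf = 2f - dκ(Jξ)`, `κ` the Ricci
potential. -/
theorem laplacian_momentum (hG : IsKahlerOn G S) {ψ : E → ℝ} (hψ : ContDiffOn ℝ ∞ ψ S)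
    (hz : z ∈ S) {ξ : E → E} {f : E → ℝ}
    (hf : ∀ x ∈ S, ∀ u, fderiv ℝ f x u = -fundForm G x (ξ x) u) (hfs : ContDiffOn ℝ ∞ f S)
    (hξ : DifferentiableAt ℝ ξ z) (hξJ : ∀ u, fderiv ℝ ξ z (J u) = J (fderiv ℝ ξ z u))
    (hlie : -∑ j, (Module.finBasis ℂ E).coord j (fderiv ℝ ξ z (stdVec j)) =
      delForm ψ z (ξ z) + Complex.I * (f z : ℂ)) :
    laplacian G f z = 2 * f z - fderiv ℝ (ricciPotential G ψ) z (J (ξ z)) := by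
  have hS := hG.isOpen.mem_nhds hz
  have hm := hG.toIsMetricOn
  have hY : HasFDerivAt (fun x => -J (ξ x)) (-(cplxJ E).comp (fderiv ℝ ξ z)) z :=
    ((cplxJ E).hasFDerivAt.comp z hξ.hasFDerivAt).neg
  rw [laplacian_eq_of_gradient hm hz (Y := fun x => -J (ξ x)) (fun x hx u => by
    rw [hf x hx]; simp [fundForm]) hY.differentiableAt (hfs.contDiffAt hS), hY.fderiv,
    fderiv_ricciPotential hm hψ hz]
  have h1 := realTrace_neg_J_comp _ hξJ
  generalize ∑ j, (Module.finBasis ℂ E).coord j (fderiv ℝ ξ z (stdVec j)) = a at h1 hlie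
  have h2 := congrArg Complex.im hlie
  simp only [Complex.neg_im, delForm, Complex.add_im, Complex.mul_im, Complex.I_re, Complex.I_im,
    Complex.ofReal_re, Complex.ofReal_im, Complex.sub_im, Complex.sub_re, Complex.mul_re] at h2
  norm_num at h2
  simp only [_root_.neg_apply, ContinuousLinearMap.comp_apply, h1, map_neg]
  linarith

end IsKahlerOn

end RicciPotential

/-! ### Comparison of the two equations -/

section Comparison

variable {E : Type*} [NormedAddCommGroup E] [NormedSpace ℂ E] [FiniteDimensional ℂ E]
  {G : E → BilForm E} {S : Set E} {z : E} {r : ℕ}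

local notation "J" => cplxJ E

theorem torusDual_eq_sum (l : TorusDual r) :
    l = ∑ i, l (Pi.single i (1 : ℝ)) • (ContinuousLinearMap.proj i : TorusDual r) := by
  ext a
  conv_lhs => rw [pi_eq_sum_univ' a]
  simp [mul_comm]

theorem clm_torusDual_apply {F : Type*} [NormedAddCommGroup F] [NormedSpace ℝ F]
    (A : TorusDual r →L[ℝ] F) (l : TorusDual r) :
    A l = ∑ i, l (Pi.single i (1 : ℝ)) • A (ContinuousLinearMap.proj i) := by
  conv_lhs => rw [torusDual_eq_sum l]
  simp

namespace IsKahlerOn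

/-- For `φ = log v(μ)` and the Ricci potential `κ`, the difference `Scal_v - w(μ)` is
`v(μ) (-Δu + ⟨du, dφ⟩)` with `u = κ - φ`. The zeroth order terms cancel because of
`laplacian_momentum`. Here `M` is the momentum map in a chart and `ξ i` are the fundamental fields
of the standard basis of the Lie algebra. -/
theorem weighted_scalarCurv_sub (hG : IsKahlerOn G S) {ψ : E → ℝ} (hψ : ContDiffOn ℝ ∞ ψ S)
    (hcurv : ∀ z ∈ S, ∀ u w, fundForm G z u w = -(1 / 2) * ddc ψ z u w) (hz : z ∈ S)
    {M : E → TorusDual r} (hM : ContDiffOn ℝ ∞ M S) {ξ : Fin r → E → E}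
    (hham : ∀ i, ∀ x ∈ S, ∀ u, fderiv ℝ (fun y => M y (Pi.single i (1 : ℝ))) x u
      = -fundForm G x (ξ i x) u)
    (hξ : ∀ i, DifferentiableAt ℝ (ξ i) z)
    (hξJ : ∀ i u, fderiv ℝ (ξ i) z (J u) = J (fderiv ℝ (ξ i) z u))
    (hlie : ∀ i, -∑ j, (Module.finBasis ℂ E).coord j (fderiv ℝ (ξ i) z (stdVec j)) =
      delForm ψ z (ξ i z) + Complex.I * (M z (Pi.single i (1 : ℝ)) : ℂ))
    {v : TorusDual r → ℝ} {U : Set (TorusDual r)} (hU : IsOpen U) (hMU : ∀ x ∈ S, M x ∈ U)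
    (hv : ContDiffOn ℝ ∞ v U) (hvpos : ∀ x ∈ S, 0 < v (M x)) :
    v (M z) * scalarCurv G z + 2 * laplacian G (fun y => v (M y)) z
      + (∑ i, ∑ j, fderiv ℝ (fderiv ℝ v) (M z) (ContinuousLinearMap.proj i)
          (ContinuousLinearMap.proj j) * G z (ξ i z) (ξ j z))
      - 2 * (Module.finrank ℂ E + fderiv ℝ (fun q => Real.log (v q)) (M z) (M z)) * v (M z) =
    v (M z) * (-laplacian G (fun y => ricciPotential G ψ y - Real.log (v (M y))) z
      + gradInner G (fun y => ricciPotential G ψ y - Real.log (v (M y)))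
        (fun y => Real.log (v (M y))) z) := by
  have hS := hG.isOpen.mem_nhds hz
  have hm := hG.toIsMetricOn
  have hg := hG.inner z hz
  set κ := ricciPotential G ψ with hκdef
  have hκ : ContDiffAt ℝ ∞ κ z := (ricciPotential_contDiffOn hm hψ).contDiffAt hS
  have hvM : ContDiffOn ℝ ∞ (fun y => v (M y)) S := hv.comp hM hMU
  have hφS : ContDiffOn ℝ ∞ (fun y => Real.log (v (M y))) S :=
    hvM.log fun x hx => (hvpos x hx).ne'
  set φ : E → ℝ := fun y => Real.log (v (M y)) with hφdef
  have hφ : ContDiffAt ℝ ∞ φ z := hφS.contDiffAt hS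
  have hexp : (fun y => v (M y)) =ᶠ[𝓝 z] fun y => Real.exp (φ y) := by
    filter_upwards [hS] with x hx
    rw [hφdef, Real.exp_log (hvpos x hx)]
  have hvx : ∀ x ∈ S, DifferentiableAt ℝ v (M x) := fun x hx =>
    (hv.contDiffAt (hU.mem_nhds (hMU x hx))).differentiableAt (by simp)
  have hMx : ∀ x ∈ S, DifferentiableAt ℝ M x := fun x hx =>
    (hM.contDiffAt (hG.isOpen.mem_nhds hx)).differentiableAt (by simp)
  have hc : ∀ i, ContDiffOn ℝ ∞ (fun y => M y (Pi.single i (1 : ℝ))) S := fun i =>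
    hM.clm_apply contDiffOn_const
  have hd2v : DifferentiableAt ℝ (fderiv ℝ v) (M z) :=
    differentiableAt_fderiv (hv.contDiffAt (hU.mem_nhds (hMU z hz)))
  -- first and second partial derivatives of `v`
  set p : Fin r → E → ℝ := fun i y => fderiv ℝ v (M y) (ContinuousLinearMap.proj i) with hp
  set q : Fin r → Fin r → ℝ := fun i j => fderiv ℝ (fderiv ℝ v) (M z)
    (ContinuousLinearMap.proj i) (ContinuousLinearMap.proj j) with hq
  have hdc : ∀ x ∈ S, ∀ i u, fderiv ℝ (fun y => M y (Pi.single i (1 : ℝ))) x u =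
      fderiv ℝ M x u (Pi.single i (1 : ℝ)) := fun x hx i u => fderiv_clm_apply_const (hMx x hx) u _
  have hdV : ∀ x ∈ S, fderiv ℝ (fun y => v (M y)) x =
      ∑ i, p i x • fderiv ℝ (fun y => M y (Pi.single i (1 : ℝ))) x := fun x hx => by
    ext u
    have h1 : HasFDerivAt (fun y => v (M y)) _ x :=
      (hvx x hx).hasFDerivAt.comp x (hMx x hx).hasFDerivAt
    rw [h1.fderiv, ContinuousLinearMap.comp_apply, clm_torusDual_apply]
    simp [hdc x hx, hp, mul_comm]
  have hpd : ∀ i, HasFDerivAt (p i)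
      (((fderiv ℝ (fderiv ℝ v) (M z)).comp (fderiv ℝ M z)).flip (ContinuousLinearMap.proj i)) z :=
    fun i => by
      have h1 := (hd2v.hasFDerivAt.comp z (hMx z hz).hasFDerivAt).clm_apply
        (hasFDerivAt_const (ContinuousLinearMap.proj i : TorusDual r) z)
      refine h1.congr_fderiv ?_
      ext u
      simp
  have hlapV := laplacian_of_fderiv_eq_sum (G := G) (q := q)
    (fun i => (hc i).contDiffAt hS) (fun i => (hpd i).differentiableAt)
    (Filter.eventually_of_mem hS hdV) (fun i u => by
      rw [(hpd i).fderiv]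
      simp only [ContinuousLinearMap.flip_apply, ContinuousLinearMap.comp_apply]
      rw [clm_torusDual_apply (fderiv ℝ (fderiv ℝ v) (M z)) (fderiv ℝ M z u)]
      simp [hdc z hz, hq, mul_comm])
  have hlapc : ∀ i, laplacian G (fun y => M y (Pi.single i (1 : ℝ))) z =
      2 * M z (Pi.single i (1 : ℝ)) - fderiv ℝ κ z (J (ξ i z)) := fun i =>
    laplacian_momentum hG hψ hz (hham i) (hc i) (hξ i) (hξJ i) (hlie i)
  have hgrad : ∀ i u, fderiv ℝ (fun y => M y (Pi.single i (1 : ℝ))) z u = G z (-J (ξ i z)) u :=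
    fun i u => by rw [hham i z hz]; simp [fundForm]
  have hgc : ∀ j i, gradInner G (fun y => M y (Pi.single j (1 : ℝ)))
      (fun y => M y (Pi.single i (1 : ℝ))) z = G z (ξ j z) (ξ i z) := fun j i => by
    rw [gradInner_eq_of_right hg (hgrad i), hgrad j]
    simp [hG.invJ z hz]
  simp only [hgc, hlapc] at hlapV
  have hκV : gradInner G κ (fun y => v (M y)) z = -∑ i, p i z * fderiv ℝ κ z (J (ξ i z)) := by
    rw [gradInner_eq_of_right hg (y := -∑ i, p i z • J (ξ i z))]
    · simp
    · intro u
      rw [hdV z hz]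
      simp [hgrad]
  have hκV' : gradInner G κ (fun y => v (M y)) z = v (M z) * gradInner G κ φ z := by
    rw [gradInner_symm hg κ φ, gradInner_symm hg, gradInner_congr_left hexp,
      gradInner_exp_left (hφ.differentiableAt (by simp)), ← hexp.eq_of_nhds]
  have hlapφ : laplacian G (fun y => v (M y)) z =
      v (M z) * (laplacian G φ z - gradInner G φ φ z) := by
    rw [laplacian_congr hexp, laplacian_exp hφ, ← hexp.eq_of_nhds]
  have hlogv : fderiv ℝ (fun q => Real.log (v q)) (M z) (M z) * v (M z) =
      ∑ i, p i z * M z (Pi.single i (1 : ℝ)) := by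
    rw [fderiv.log (hvx z hz) (hvpos z hz).ne', _root_.smul_apply, clm_torusDual_apply]
    simp only [smul_eq_mul]
    rw [mul_comm, mul_inv_cancel_left₀ (hvpos z hz).ne']
    exact Finset.sum_congr rfl fun i _ => mul_comm _ _
  have hsub : (fun y => κ y - φ y) = fun y => κ y + (-1) * φ y := by ext y; ring
  have hφ' : ContDiffAt ℝ ∞ (fun y => (-1) * φ y) z := contDiffAt_const.mul hφ
  have hscal := scalarCurv_eq hG hψ hcurv hz
  rw [← hκdef] at hscal
  have hgoal : (fun y => κ y - Real.log (v (M y))) = fun y => κ y - φ y := rfl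
  rw [hgoal, hsub, laplacian_add hκ hφ', laplacian_const_mul,
    gradInner_add_left (hκ.differentiableAt (by simp)) (hφ'.differentiableAt (by simp)),
    gradInner_const_mul_left, hscal]
  simp only [mul_sub, Finset.sum_sub_distrib] at hlapV
  have h2 : ∑ i, p i z * (2 * M z (Pi.single i (1 : ℝ))) =
      2 * ∑ i, p i z * M z (Pi.single i (1 : ℝ)) := by
    rw [Finset.mul_sum]
    exact Finset.sum_congr rfl fun i _ => by ring
  rw [h2, ← hlogv] at hlapV
  rw [hκV] at hκV'
  linarith

end IsKahlerOn

end Comparison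

/-! ### The strong maximum principle -/

section MaximumPrinciple

/-- The geometric part of Hopf's strong maximum principle. Suppose that `f ≤ M` on the open set `S`
and that near each `z ∈ S`, for each `q ≠ z`, some Gaussian bump `exp (-α |x - q|²)` has the
property that no positive multiple of it can be added to `f` to produce a local maximum. Then
`{f = M}` is open in `S`: otherwise there is a closed ball, centred at some `q`, on which `f < M`
except at one point `z` of its boundary, and adding a small multiple of the bump produces a local
maximum near `z`. -/
theorem eventually_eq_of_no_barrier {W : Type*} [NormedAddCommGroup W] [InnerProductSpace ℝ W]
    [FiniteDimensional ℝ W] {S : Set W} (hS : IsOpen S) {f : W → ℝ} (hf : ContinuousOn f S)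
    {M : ℝ} (hM : ∀ x ∈ S, f x ≤ M)
    (hbar : ∀ z ∈ S, ∀ q, q ≠ z → ∃ α : ℝ, 0 < α ∧ ∃ N ∈ 𝓝 z, ∀ δ : ℝ, 0 < δ → ∀ y ∈ N,
      ¬ IsLocalMax (fun x => f x + δ * Real.exp (-α * ‖x - q‖ ^ 2)) y)
    {p : W} (hp : p ∈ S) (hpM : f p = M) : ∀ᶠ x in 𝓝 p, f x = M := by
  obtain ⟨ρ, hρ, hρS⟩ := Metric.isOpen_iff.mp hS p hp
  rw [Metric.eventually_nhds_iff_ball]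
  refine ⟨ρ / 4, by positivity, fun q₀ hq₀ => ?_⟩
  by_contra hne
  -- `z` is a point of `{f = M}` closest to `q₀`
  have hsub : Metric.closedBall p (ρ / 2) ⊆ S :=
    (Metric.closedBall_subset_ball (by linarith)).trans hρS
  let K := Metric.closedBall p (ρ / 2) ∩ f ⁻¹' {M}
  have hK : IsCompact K :=
    (isCompact_closedBall p (ρ / 2)).of_isClosed_subset
      ((hf.mono hsub).preimage_isClosed_of_isClosed Metric.isClosed_closedBall isClosed_singleton)
      Set.inter_subset_left
  have hpK : p ∈ K := ⟨Metric.mem_closedBall_self (by positivity), hpM⟩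
  obtain ⟨z, hzK, hz⟩ := hK.exists_isMinOn ⟨p, hpK⟩
    (continuous_id.dist continuous_const : Continuous fun x => dist x q₀).continuousOn
  have hzM : f z = M := hzK.2
  have hzS : z ∈ S := hsub hzK.1
  rw [Metric.mem_ball] at hq₀
  have hd : dist z q₀ < ρ / 4 := lt_of_le_of_lt (hz hpK) (by simpa [dist_comm] using hq₀)
  have hzq : q₀ ≠ z := fun h => hne (h ▸ hzM)
  set R := dist z q₀ with hR
  have hRpos : 0 < R := dist_pos.mpr hzq.symm
  have hlt : ∀ x, dist x q₀ < R → x ∈ S ∧ f x < M := fun x hx => by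
    have hxK : x ∈ Metric.closedBall p (ρ / 2) := by
      rw [Metric.mem_closedBall]
      linarith [dist_triangle x q₀ p]
    refine ⟨hsub hxK, lt_of_le_of_ne (hM x (hsub hxK)) fun h => ?_⟩
    have h2 : R ≤ dist x q₀ := hz (show x ∈ K from ⟨hxK, h⟩)
    linarith
  -- halving the ball leaves `z` as the only boundary point with value `M`
  let q := midpoint ℝ q₀ z
  have hqz : dist z q = R / 2 := by
    simp [q, hR, dist_comm]
    ring
  have hqq : dist q q₀ = R / 2 := by
    simp [q, hR, dist_comm]
    ring
  have hlt' : ∀ x, dist x q ≤ R / 2 → x ≠ z → f x < M := fun x hx hxz => by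
    refine (hlt x ?_).2
    by_contra! h
    have h1 := dist_triangle x q q₀
    have h2 : q = midpoint ℝ x q₀ :=
      eq_midpoint_of_dist_eq_half (by linarith) (by linarith)
    have h3 : midpoint ℝ x q₀ = midpoint ℝ z q₀ := by rw [← h2, midpoint_comm z]
    simp [midpoint_eq_smul_add, hxz] at h3
  obtain ⟨α, hα, N, hN, hnot⟩ := hbar z hzS q (by
    intro h; rw [h, dist_self] at hqz; linarith)
  obtain ⟨ε, hε, hεN⟩ := Metric.nhds_basis_closedBall.mem_iff.mp
    (Filter.inter_mem hN (hS.mem_nhds hzS))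
  have hfε : ContinuousOn f (Metric.closedBall z ε) := hf.mono fun x hx => (hεN hx).2
  -- `δ` is small enough for the bump not to lift `f` to `M` on the part of the sphere in the ball
  obtain ⟨δ, hδ, hδM⟩ : ∃ δ : ℝ, 0 < δ ∧
      ∀ x ∈ Metric.sphere z ε ∩ Metric.closedBall q (R / 2), f x + δ < M := by
    have hC : IsCompact (Metric.sphere z ε ∩ Metric.closedBall q (R / 2)) :=
      (isCompact_sphere z ε).inter_right Metric.isClosed_closedBall
    rcases (Metric.sphere z ε ∩ Metric.closedBall q (R / 2)).eq_empty_or_nonempty with h | h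
    · exact ⟨1, one_pos, fun x hx => by simp [h] at hx⟩
    obtain ⟨y, hy, hymax⟩ := hC.exists_isMaxOn h
      (hfε.mono fun x hx => Metric.sphere_subset_closedBall hx.1)
    have hyM : f y < M := hlt' y hy.2 fun h => by
      have := hy.1
      rw [h, Metric.mem_sphere, dist_self] at this
      linarith
    refine ⟨(M - f y) / 2, by linarith, fun x hx => ?_⟩
    have : f x ≤ f y := hymax hx
    linarith
  obtain ⟨y, hy, hymax⟩ := (isCompact_closedBall z ε).exists_isMaxOn
    ⟨z, Metric.mem_closedBall_self hε.le⟩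
    (hfε.add (continuous_const.mul (Real.continuous_exp.comp (continuous_const.mul
      ((continuous_id.sub continuous_const).norm.pow 2)))).continuousOn :
      ContinuousOn (fun x => f x + δ * Real.exp (-α * ‖x - q‖ ^ 2)) (Metric.closedBall z ε))
  have hyz : f z + δ * Real.exp (-α * ‖z - q‖ ^ 2) ≤ f y + δ * Real.exp (-α * ‖y - q‖ ^ 2) :=
    hymax (Metric.mem_closedBall_self hε.le)
  rw [hzM] at hyz
  have hzpos := mul_pos hδ (Real.exp_pos (-α * ‖z - q‖ ^ 2))
  have hyint : dist y z < ε := by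
    refine lt_of_le_of_ne hy fun hys => ?_
    by_cases hyq : dist y q ≤ R / 2
    · have h1 := hδM y ⟨hys, hyq⟩
      have h2 : Real.exp (-α * ‖y - q‖ ^ 2) ≤ 1 := by
        rw [Real.exp_le_one_iff]
        nlinarith [sq_nonneg ‖y - q‖]
      nlinarith
    · have h1 := hM y (hεN hy).2
      have h2 : Real.exp (-α * ‖y - q‖ ^ 2) < Real.exp (-α * ‖z - q‖ ^ 2) := by
        rw [Real.exp_lt_exp, ← dist_eq_norm, ← dist_eq_norm, hqz]
        push Not at hyq
        have : (R / 2) ^ 2 < dist y q ^ 2 := by gcongr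
        nlinarith
      nlinarith
  exact hnot δ hδ y (hεN hy).1
    (hymax.isLocalMax (Filter.mem_of_superset (Metric.isOpen_ball.mem_nhds hyint)
      Metric.ball_subset_closedBall))

/-- At a local maximum the second derivative is negative semidefinite. -/
theorem fderiv_fderiv_nonpos_of_isLocalMax {V : Type*} [NormedAddCommGroup V] [NormedSpace ℝ V]
    {f : V → ℝ} {z : V} (hf : ContDiffAt ℝ ∞ f z) (h : IsLocalMax f z) (u : V) :
    fderiv ℝ (fderiv ℝ f) z u u ≤ 0 := by
  by_contra! hpos
  -- along a line the second derivative test gives a local minimum, so `f` is locally constant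
  let l : ℝ → V := fun t => z + t • u
  have hl : ∀ t, HasDerivAt l u t := fun t => by
    have h := ((hasDerivAt_id t).smul_const u).const_add z
    rw [one_smul] at h
    exact h
  have hl0 : l 0 = z := by simp [l]
  have hlc : Filter.Tendsto l (𝓝 0) (𝓝 z) := by
    simpa [hl0] using (hl 0).continuousAt.tendsto
  have h1 : deriv (fun t => f (l t)) =ᶠ[𝓝 0] fun t => fderiv ℝ f (l t) u := by
    filter_upwards [hlc.eventually (eventually_differentiableAt hf)] with t ht
    exact (ht.hasFDerivAt.comp_hasDerivAt t (hl t)).deriv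
  have h2 : deriv (deriv (fun t => f (l t))) 0 = fderiv ℝ (fderiv ℝ f) z u u := by
    rw [h1.deriv_eq]
    have h3 : HasFDerivAt (fderiv ℝ f) (fderiv ℝ (fderiv ℝ f) z) (l 0) := by
      rw [hl0]; exact (differentiableAt_fderiv hf).hasFDerivAt
    have h4 := (h3.comp_hasDerivAt 0 (hl 0)).clm_apply (hasDerivAt_const 0 u)
    simpa using h4.deriv
  have hc : ContinuousAt (fun t => f (l t)) 0 := by
    refine ContinuousAt.comp (f := l) ?_ (hl 0).continuousAt
    rw [hl0]; exact hf.continuousAt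
  have hmin := isLocalMin_of_deriv_deriv_pos (f := fun t => f (l t)) (x₀ := 0) (by rwa [h2])
    (by rw [h1.eq_of_nhds, hl0, h.fderiv_eq_zero]; rfl) hc
  have hconst : (fun t => f (l t)) =ᶠ[𝓝 0] fun _ => f z := by
    filter_upwards [hmin, hlc.eventually h] with t ht ht'
    rw [hl0] at ht
    exact le_antisymm ht' ht
  have h5 : deriv (deriv (fun t => f (l t))) 0 = 0 := by
    rw [hconst.deriv.deriv_eq]
    simp
  rw [h2] at h5
  exact hpos.ne' h5

variable {V : Type*} [NormedAddCommGroup V] [NormedSpace ℝ V] [FiniteDimensional ℝ V]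
  {G : V → BilForm V} {S : Set V} {z : V}

theorem laplacian_nonneg_of_isLocalMax (hg : IsInnerForm (G z)) {f : V → ℝ}
    (hf : ContDiffAt ℝ ∞ f z) (h : IsLocalMax f z) : 0 ≤ laplacian G f z := by
  have h1 : hessian G f z = fun u w => fderiv ℝ (fderiv ℝ f) z u w := by
    ext u w
    rw [hessian, h.fderiv_eq_zero]
    simp
  rw [laplacian, h1]
  linarith [metricTrace_nonpos hg _ (fderiv_fderiv_nonpos_of_isLocalMax hf h)]

theorem gradInner_eq_zero_of_isLocalMax {f φ : V → ℝ} (h : IsLocalMax f z) :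
    gradInner G f φ z = 0 := by
  simp [gradInner, metricTrace, h.fderiv_eq_zero]

theorem continuousOn_metricTrace (hG : IsMetricOn G S) {B : V → BilForm V}
    (hB : ContinuousOn B S) : ContinuousOn (fun x => metricTrace (G x) fun u w => B x u w) S := by
  unfold metricTrace
  exact continuousOn_finsetSum _ fun a _ => (hB.clm_apply continuousOn_const).clm_apply
    (hG.inverse_contDiffOn.continuousOn.clm_apply continuousOn_const)

theorem continuousOn_laplacian (hG : IsMetricOn G S) {f : V → ℝ} (hf : ContDiffOn ℝ ∞ f S) :
    ContinuousOn (laplacian G f) S := by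
  have h1 : ContDiffOn ℝ ∞ (fderiv ℝ f) S := hf.fderiv_of_isOpen hG.isOpen (by simp)
  have h2 : ContDiffOn ℝ ∞ (fderiv ℝ (fderiv ℝ f)) S := h1.fderiv_of_isOpen hG.isOpen (by simp)
  have h3 : ContDiffOn ℝ ∞ (fun x => ContinuousLinearMap.compL ℝ V V ℝ (fderiv ℝ f x)) S :=
    (ContinuousLinearMap.compL ℝ V V ℝ).contDiff.comp_contDiffOn h1
  exact (continuousOn_metricTrace hG (B := fun x => fderiv ℝ (fderiv ℝ f) x -
    (ContinuousLinearMap.compL ℝ V V ℝ (fderiv ℝ f x)).comp (christoffel G x))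
    (h2.continuousOn.sub (h3.continuousOn.clm_comp hG.christoffel_contDiffOn.continuousOn))).neg

theorem continuousOn_gradInner (hG : IsMetricOn G S) {f φ : V → ℝ} (hf : ContDiffOn ℝ ∞ f S)
    (hφ : ContDiffOn ℝ ∞ φ S) : ContinuousOn (gradInner G f φ) S := by
  have h1 : ContinuousOn (fderiv ℝ f) S :=
    (hf.fderiv_of_isOpen (m := ∞) hG.isOpen (by simp)).continuousOn
  have h2 : ContinuousOn (fderiv ℝ φ) S :=
    (hφ.fderiv_of_isOpen (m := ∞) hG.isOpen (by simp)).continuousOn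
  exact continuousOn_metricTrace hG (B := fun x => (fderiv ℝ f x).smulRight (fderiv ℝ φ x))
    (((ContinuousLinearMap.smulRightL ℝ V (V →L[ℝ] ℝ)).continuous.comp_continuousOn h1).clm_apply
      h2)

/-- Hopf's strong maximum principle for the drift Laplacian `-Δf + ⟨df, dφ⟩`: the set where a
solution attains its maximum is open. -/
theorem eventually_eq_of_drift_laplacian_eq_zero (hG : IsMetricOn G S) {f φ : V → ℝ}
    (hf : ContDiffOn ℝ ∞ f S) (hφ : ContDiffOn ℝ ∞ φ S)
    (hL : ∀ x ∈ S, -laplacian G f x + gradInner G f φ x = 0) {M : ℝ} (hM : ∀ x ∈ S, f x ≤ M)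
    {p : V} (hp : p ∈ S) (hpM : f p = M) : ∀ᶠ x in 𝓝 p, f x = M := by
  let T := toEuclidean (E := V)
  have hTS : IsOpen (T.symm ⁻¹' S) := hG.isOpen.preimage T.symm.continuous
  have key := eventually_eq_of_no_barrier (f := fun x => f (T.symm x)) hTS
    (hf.continuousOn.comp T.symm.continuous.continuousOn fun x hx => hx) (fun x hx => hM _ hx) ?_
    (p := T p) (by simpa using hp) (by simpa using hpM)
  · have := T.continuous.continuousAt.eventually key
    simpa using this
  -- only the bumps of `eventually_eq_of_no_barrier` remain to be constructed
  intro z' hz' q hqz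
  obtain ⟨z, rfl⟩ := T.surjective z'
  have hz : z ∈ S := by simpa using hz'
  have hg := hG.inner z hz
  -- the squared Euclidean distance to `q`, whose differential does not vanish at `z`
  let Q : V → ℝ := fun x => ‖T x - q‖ ^ 2
  have hQ : ContDiff ℝ ∞ Q := (T.contDiff.sub contDiff_const).norm_sq ℝ
  have hdQ : fderiv ℝ Q z ≠ 0 := by
    intro h0
    have h1 : HasFDerivAt Q _ z := (T.hasFDerivAt.sub_const q).norm_sq
    rw [h1.fderiv] at h0
    have h2 := congrArg (fun l : V →L[ℝ] ℝ => l (T.symm (T z - q))) h0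
    have h3 : (2 : ℝ) * inner ℝ (T z - q) (T z - q) = 0 := by
      simpa [-map_sub] using h2
    rw [mul_eq_zero_iff_left two_ne_zero, inner_self_eq_zero, sub_eq_zero] at h3
    exact hqz h3.symm
  have hc := gradInner_self_pos hg hdQ
  set c := gradInner G Q Q z with hcdef
  set L₀ := -laplacian G Q z + gradInner G Q φ z with hL₀
  -- `L exp(-αQ) = exp(-αQ) (α² |dQ|² - α L Q)` is positive near `z` for large `α`
  set α := (|L₀| + 1) / c with hα
  have hαpos : 0 < α := by positivity
  let b : V → ℝ := fun x => Real.exp (-α * Q x)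
  have hb : ContDiff ℝ ∞ b := Real.contDiff_exp.comp (contDiff_const.mul hQ)
  have hbz : 0 < -laplacian G b z + gradInner G b φ z := by
    have h1 : ContDiffAt ℝ ∞ (fun x => -α * Q x) z := (contDiff_const.mul hQ).contDiffAt
    rw [laplacian_exp h1, gradInner_exp_left (h1.differentiableAt (by simp)), laplacian_const_mul,
      gradInner_const_mul_left, gradInner_const_mul_left, gradInner_symm hg Q,
      gradInner_const_mul_left, ← hcdef]
    have h2 : α * c = |L₀| + 1 := by rw [hα]; field_simp
    have h3 : -(Real.exp (-α * Q z) * (-α * laplacian G Q z - -α * (-α * c))) +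
        Real.exp (-α * Q z) * (-α * gradInner G Q φ z) =
        Real.exp (-α * Q z) * (α * (α * c - L₀)) := by rw [hL₀]; ring
    rw [h3, h2]
    have h4 := le_abs_self L₀
    have h5 : 0 < |L₀| + 1 - L₀ := by linarith
    positivity
  have hev : ∀ᶠ x in 𝓝 z, x ∈ S ∧ 0 < -laplacian G b x + gradInner G b φ x := by
    have hcont : ContinuousAt (fun x => -laplacian G b x + gradInner G b φ x) z :=
      ((continuousOn_laplacian hG hb.contDiffOn).neg.add
        (continuousOn_gradInner hG hb.contDiffOn hφ)).continuousAt (hG.isOpen.mem_nhds hz)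
    exact (hG.isOpen.eventually_mem hz).and (hcont.eventually_const_lt hbz)
  refine ⟨α, hαpos, T.symm ⁻¹' {x | x ∈ S ∧ 0 < -laplacian G b x + gradInner G b φ x}, ?_, ?_⟩
  · refine T.symm.continuous.continuousAt.preimage_mem_nhds ?_
    rw [T.symm_apply_apply]
    exact hev
  intro δ hδ y' hy hmax
  obtain ⟨y, rfl⟩ := T.surjective y'
  simp only [Set.mem_preimage, T.symm_apply_apply] at hy
  obtain ⟨hyS, hypos⟩ : y ∈ S ∧ 0 < -laplacian G b y + gradInner G b φ y := hy
  have hmax' : IsLocalMax (fun x => f x + δ * b x) y := by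
    have h1 := T.continuous.continuousAt.eventually hmax
    simpa [IsLocalMax, IsMaxFilter, b, Q] using h1
  have hfy := hf.contDiffAt (hG.isOpen.mem_nhds hyS)
  have hby : ContDiffAt ℝ ∞ (fun x => δ * b x) y := (contDiff_const.mul hb).contDiffAt
  have h1 := laplacian_nonneg_of_isLocalMax (hG.inner y hyS) (hfy.add hby) hmax'
  have h2 := gradInner_eq_zero_of_isLocalMax (G := G) (φ := φ) hmax'
  have h3 : laplacian G (fun x => f x + δ * b x) y = _ := laplacian_add hfy hby
  rw [laplacian_const_mul] at h3
  rw [gradInner_add_left (hfy.differentiableAt (by simp)) (hby.differentiableAt (by simp)),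
    gradInner_const_mul_left] at h2
  have h4 := hL y hyS
  have h5 := mul_pos hδ hypos
  have h6 : 0 ≤ laplacian G f y + δ * laplacian G b y := h3 ▸ h1
  nlinarith

end MaximumPrinciple

/-! ### Independence of the Ricci potential from the frame -/

section FrameChange

variable {E : Type*} [NormedAddCommGroup E] [NormedSpace ℂ E] [FiniteDimensional ℂ E]
  {T : Type*} [AddCommGroup T] [Module ℂ T]

/-- An alternating map of top degree is multiplied by the determinant under a change of frame. -/
theorem alternatingMap_comp_eq_det_smul {N : Type*} [AddCommGroup N] [Module ℂ N]
    (f : E [⋀^Fin (Module.finrank ℂ E)]→ₗ[ℂ] N) (C : E →ₗ[ℂ] E) :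
    f (fun j => C (stdVec j)) = LinearMap.det C • f stdVec := by
  have h1 : f = (LinearMap.toSpanSingleton ℂ N (f stdVec)).compAlternatingMap
      (Module.finBasis ℂ E).det := by
    refine Module.Basis.ext_alternating (Module.finBasis ℂ E) fun v hv => ?_
    obtain ⟨σ, rfl⟩ : ∃ σ : Equiv.Perm (Fin (Module.finrank ℂ E)), v = σ :=
      ⟨Equiv.ofBijective v (Finite.injective_iff_bijective.mp hv), rfl⟩
    have h2 := f.map_perm stdVec σ
    have h3 := (Module.finBasis ℂ E).det.map_perm (Module.finBasis ℂ E) σ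
    rw [Module.Basis.det_self] at h3
    simp only [LinearMap.compAlternatingMap_apply, LinearMap.toSpanSingleton_apply]
    exact h2.trans (by
      rw [show (fun i => (Module.finBasis ℂ E) (σ i)) = (Module.finBasis ℂ E) ∘ σ from rfl, h3]
      rw [Units.smul_def, Units.smul_def, zsmul_one, Int.cast_smul_eq_zsmul])
  have h4 := congrArg (fun f : E [⋀^Fin (Module.finrank ℂ E)]→ₗ[ℂ] N => f fun j => C (stdVec j)) h1
  refine h4.trans ?_
  simp only [LinearMap.compAlternatingMap_apply, LinearMap.toSpanSingleton_apply]
  congr 1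
  have h5 := (Module.finBasis ℂ E).det_comp C (Module.finBasis ℂ E)
  rw [Module.Basis.det_self, mul_one] at h5
  exact h5

theorem ιMulti_frame_ne_zero (A : E ≃ₗ[ℂ] T) :
    exteriorPower.ιMulti ℂ (Module.finrank ℂ E) (fun j => A (stdVec j)) ≠ 0 := by
  let b := (Module.finBasis ℂ E).map A
  intro h
  have h1 := exteriorPower.alternatingMapLinearEquiv_apply_ιMulti b.det fun j => A (stdVec j)
  rw [h, map_zero] at h1
  have h2 := b.det_self
  exact one_ne_zero (h2.symm.trans h1.symm)

/-- The pull-back to `E` of a real bilinear form on `T`. -/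
def pullForm (g : T →ₗ[ℝ] T →ₗ[ℝ] ℝ) (A : E →ₗ[ℂ] T) : BilForm E :=
  LinearMap.toContinuousBilinearMap (g.compl₁₂ (A.restrictScalars ℝ) (A.restrictScalars ℝ))

theorem pullForm_apply (g : T →ₗ[ℝ] T →ₗ[ℝ] ℝ) (A : E →ₗ[ℂ] T) (u w : E) :
    pullForm g A u w = g (A u) (A w) := rfl

/-- The Ricci potential at a point, computed in a complex frame `A` of the tangent space `T` from a
squared norm `N` on the top exterior power and an inner product `g`. -/
def framePotential (N : ⋀[ℂ]^(Module.finrank ℂ E) T → ℝ) (g : T →ₗ[ℝ] T →ₗ[ℝ] ℝ)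
    (A : E ≃ₗ[ℂ] T) : ℝ :=
  Real.log (N (exteriorPower.ιMulti ℂ (Module.finrank ℂ E) fun j => A (stdVec j)))
    - 1 / 2 * logGramDet (pullForm g (A : E →ₗ[ℂ] T))

/-- The Ricci potential does not depend on the frame: both determinants change by the same
factor. -/
theorem framePotential_eq (N : ⋀[ℂ]^(Module.finrank ℂ E) T → ℝ)
    (hN : ∀ (c : ℂ) s, N (c • s) = ‖c‖ ^ 2 * N s) (hNpos : ∀ s, s ≠ 0 → 0 < N s)
    (g : T →ₗ[ℝ] T →ₗ[ℝ] ℝ) (hsymm : ∀ u w, g u w = g w u) (hpos : ∀ u, u ≠ 0 → 0 < g u u)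
    (A B : E ≃ₗ[ℂ] T) : framePotential N g A = framePotential N g B := by
  let C : E ≃ₗ[ℂ] E := A.trans B.symm
  have hC : ∀ u, A u = B (C u) := fun u => by simp [C]
  have hdet : LinearMap.det (C : E →ₗ[ℂ] E) ≠ 0 := (LinearEquiv.isUnit_det' C).ne_zero
  have h1 : exteriorPower.ιMulti ℂ (Module.finrank ℂ E) (fun j => A (stdVec j)) =
      LinearMap.det (C : E →ₗ[ℂ] E) •
        exteriorPower.ιMulti ℂ (Module.finrank ℂ E) (fun j => B (stdVec j)) := by
    simp only [hC]
    exact alternatingMap_comp_eq_det_smul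
      ((exteriorPower.ιMulti ℂ (Module.finrank ℂ E)).compLinearMap (B : E →ₗ[ℂ] T)) C
  have hB : IsInnerForm (pullForm g (B : E →ₗ[ℂ] T)) :=
    ⟨fun u w => hsymm _ _, fun u hu => hpos _ (by simpa using hu)⟩
  have h2 := det_gram_comp (pullForm g (B : E →ₗ[ℂ] T)) (Module.finBasis ℝ E)
    ((C : E →ₗ[ℂ] E).restrictScalars ℝ)
  have h3 : LinearMap.det ((C : E →ₗ[ℂ] E).restrictScalars ℝ) =
      ‖LinearMap.det (C : E →ₗ[ℂ] E)‖ ^ 2 := by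
    rw [LinearMap.det_restrictScalars, Algebra.norm_complex_apply, Complex.normSq_eq_norm_sq]
  have h4 : logGramDet (pullForm g (A : E →ₗ[ℂ] T)) =
      4 * Real.log ‖LinearMap.det (C : E →ₗ[ℂ] E)‖ + logGramDet (pullForm g (B : E →ₗ[ℂ] T)) := by
    have h5 : (Matrix.of fun i j => pullForm g (A : E →ₗ[ℂ] T) (Module.finBasis ℝ E i)
        (Module.finBasis ℝ E j)).det = (Matrix.of fun i j => pullForm g (B : E →ₗ[ℂ] T)
          ((C : E →ₗ[ℂ] E).restrictScalars ℝ (Module.finBasis ℝ E i))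
          ((C : E →ₗ[ℂ] E).restrictScalars ℝ (Module.finBasis ℝ E j))).det := by
      congr 1
      ext i j
      simp [pullForm_apply, hC]
    rw [logGramDet, h5, h2, h3, Real.log_mul (by positivity) (hB.det_gram_pos _).ne', ← pow_mul,
      Real.log_pow, logGramDet]
    norm_num
  rw [framePotential, framePotential, h1, hN, h4, Real.log_mul (by positivity)
    (hNpos _ (ιMulti_frame_ne_zero B)).ne', Real.log_pow]
  push_cast
  ring

end FrameChange

/-! ### Kähler and hermitian metrics in charts -/

section Charts

variable {E : Type*} [NormedAddCommGroup E] [NormedSpace ℂ E] [FiniteDimensional ℂ E]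
  {X : Type*} [TopologicalSpace X] [ChartedSpace E X] [IsManifold 𝓘(ℂ, E) ω X]
  {e : OpenPartialHomeomorph X E} {z : E}

/-- The differential of the inverse of a chart is an isomorphism onto the tangent space. -/
theorem exists_equiv_chartFrame (he : e ∈ atlas E X) (hz : z ∈ e.target) :
    ∃ A : E ≃ₗ[ℂ] Tan E (e.symm z), (A : E →ₗ[ℂ] Tan E (e.symm z)) = chartFrame e z := by
  have : IsManifold 𝓘(ℂ, E) 1 X := IsManifold.of_le (n := ω) le_top
  have h := (mdifferentiable_of_mem_atlas (I := 𝓘(ℂ, E)) he).symm.mfderiv_bijective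
    (x := z) (by simpa using hz)
  exact ⟨LinearEquiv.ofBijective (chartFrame e z) h, rfl⟩

theorem KahlerMetric.loc_apply (Ω : KahlerMetric E X) (u w : E) :
    Ω.loc e z u w = Ω.g (e.symm z) (chartFrame e z u) (chartFrame e z w) := rfl

theorem KahlerMetric.isKahlerOn (Ω : KahlerMetric E X) (he : e ∈ atlas E X) :
    IsKahlerOn (Ω.loc e) e.target where
  isOpen := e.open_target
  smooth := Ω.smooth e he
  inner z hz := by
    obtain ⟨A, hA⟩ := exists_equiv_chartFrame he hz
    refine ⟨fun u w => Ω.symm _ _ _, fun u hu => ?_⟩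
    rw [Ω.loc_apply, ← hA]
    exact Ω.pos _ _ (by simpa using hu)
  invJ z hz u w := by
    rw [Ω.loc_apply, Ω.loc_apply, cplxJ_apply, cplxJ_apply,
      (chartFrame e z).map_smul, (chartFrame e z).map_smul, Ω.invJ]
  closed := Ω.closed e he

theorem AnticanMetric.logNorm_contDiffOn (H : AnticanMetric E X) (he : e ∈ atlas E X) :
    ContDiffOn ℝ ∞ (H.logNorm e) e.target := by
  refine (H.smooth e he).log fun z hz => (H.pos _ _ ?_).ne'
  obtain ⟨A, hA⟩ := exists_equiv_chartFrame he hz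
  have := ιMulti_frame_ne_zero A
  rw [anticanFrame, ← hA]
  exact this

/-- The identification of the tangent space at `x` with the model space. -/
def tanEquiv (x : X) : E ≃ₗ[ℂ] Tan E x := LinearEquiv.refl ℂ E

/-- The Ricci potential of a Kähler metric `Ω`, relative to a hermitian metric on `K_X⁻¹`, as a
global function: `log` of the ratio of that metric and the one induced by `Ω`. It is computed in the
standard frame of `T_xX = E`, but by `framePotential_eq` any other frame gives the same value. -/
def globalPotential (Ω : KahlerMetric E X) (H : AnticanMetric E X) (x : X) : ℝ :=
  framePotential (H.normSq x) (Ω.g x) (tanEquiv x)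

/-- In every chart the global potential is the local one; in particular it is smooth. -/
theorem ricciPotential_eq_globalPotential (Ω : KahlerMetric E X) (H : AnticanMetric E X)
    (he : e ∈ atlas E X) (hz : z ∈ e.target) :
    ricciPotential (Ω.loc e) (H.logNorm e) z = globalPotential Ω H (e.symm z) := by
  obtain ⟨A, hA⟩ := exists_equiv_chartFrame he hz
  rw [globalPotential, framePotential_eq _ (H.normSq_smul _) (H.pos _) _ (Ω.symm _) (Ω.pos _)
    (tanEquiv _) A,
    framePotential, hA, ricciPotential]
  have : (fun j => A (stdVec j)) = fun j => chartFrame e z (stdVec j) := by rw [← hA]; rfl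
  rw [this]
  rfl

end Charts

/-! ### The underlying real manifold -/

section ComplexManifold

variable {E : Type*} [NormedAddCommGroup E] [NormedSpace ℂ E]
  {X : Type*} [TopologicalSpace X] [ChartedSpace E X] [IsManifold 𝓘(ℂ, E) ω X]
  {e : OpenPartialHomeomorph X E} {z : E}

local notation "J" => cplxJ E

section RealStructure

variable (E X) in
/-- The smooth real manifold underlying a complex manifold. -/
theorem isManifold_real : IsManifold 𝓘(ℝ, E) ∞ X := by
  refine isManifold_of_contDiffOn _ _ _ fun e e' he he' => ?_
  have h1 := StructureGroupoid.compatible (contDiffGroupoid ω 𝓘(ℂ, E)) he he'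
  rw [contDiffGroupoid, mem_groupoid_of_pregroupoid] at h1
  have h2 : ContDiffOn ℂ ω (𝓘(ℂ, E) ∘ (e.symm ≫ₕ e') ∘ 𝓘(ℂ, E).symm)
    (𝓘(ℂ, E).symm ⁻¹' (e.symm ≫ₕ e').source ∩ Set.range 𝓘(ℂ, E)) := h1.1
  exact (h2.restrict_scalars ℝ).of_le le_top

theorem contMDiffOn_chart_real (he : e ∈ atlas E X) : ContMDiffOn 𝓘(ℝ, E) 𝓘(ℝ, E) ∞ e e.source :=
  have := isManifold_real E X
  contMDiffOn_of_mem_maximalAtlas (IsManifold.subset_maximalAtlas he)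

theorem contMDiffOn_chart_symm_real (he : e ∈ atlas E X) :
    ContMDiffOn 𝓘(ℝ, E) 𝓘(ℝ, E) ∞ e.symm e.target :=
  have := isManifold_real E X
  contMDiffOn_symm_of_mem_maximalAtlas (IsManifold.subset_maximalAtlas he)

theorem contDiffOn_comp_chart_symm {F : Type*} [NormedAddCommGroup F] [NormedSpace ℝ F] {f : X → F}
    (hf : ContMDiff 𝓘(ℝ, E) 𝓘(ℝ, F) ∞ f) (he : e ∈ atlas E X) :
    ContDiffOn ℝ ∞ (fun y => f (e.symm y)) e.target :=
  contMDiffOn_iff_contDiffOn.mp (hf.comp_contMDiffOn (contMDiffOn_chart_symm_real he))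

end RealStructure

/-! ### The fundamental fields are holomorphic -/

section Action

variable {r : ℕ} [MulAction (Torus r) X]

/-- The flow of `ξ` in a chart. -/
def flowChart (ξ : Fin r → ℝ) (e : OpenPartialHomeomorph X E) (p : ℝ × E) : E :=
  e (torusExp (p.1 • ξ) • e.symm p.2)

theorem torusExp_zero : torusExp (0 : Fin r → ℝ) = 1 := by
  ext j
  simp [torusExp]

theorem contMDiffAt_flow (hT : IsHolomorphicAction E X r) (ξ : Fin r → ℝ)
    (he : e ∈ atlas E X) (hz : z ∈ e.target) (t : ℝ) :
    ContMDiffAt 𝓘(ℝ, ℝ × E) 𝓘(ℝ, E) ∞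
      (fun p : ℝ × E => torusExp (p.1 • ξ) • e.symm p.2) (t, z) := by
  have h1 : ContMDiffAt 𝓘(ℝ, ℝ × E) 𝓘(ℝ, Fin r → ℝ) ∞ (fun p : ℝ × E => p.1 • ξ) (t, z) :=
    (contDiff_fst.smul contDiff_const).contDiffAt.contMDiffAt
  have h2 : ContMDiffAt 𝓘(ℝ, ℝ × E) 𝓘(ℝ, E) ∞ (fun p : ℝ × E => e.symm p.2) (t, z) :=
    ContMDiffAt.comp (t, z) (g := e.symm) (f := Prod.snd)
      ((contMDiffOn_chart_symm_real he).contMDiffAt (e.open_target.mem_nhds hz))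
      contDiff_snd.contDiffAt.contMDiffAt
  exact (hT.smooth.contMDiffAt).comp (t, z) (h1.prodMk h2)

theorem contDiffAt_flowChart (hT : IsHolomorphicAction E X r) (ξ : Fin r → ℝ)
    (he : e ∈ atlas E X) (hz : z ∈ e.target) :
    ContDiffAt ℝ ∞ (flowChart ξ e) (0, z) := by
  have h1 := contMDiffAt_flow hT ξ he hz 0
  have h2 : torusExp ((0 : ℝ) • ξ) • e.symm z = e.symm z := by
    rw [zero_smul, torusExp_zero, one_smul]
  refine ContMDiffAt.contDiffAt (ContMDiffAt.comp (0, z) (g := e) ?_ h1)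
  rw [show ((0, z) : ℝ × E).2 = z from rfl, show ((0, z) : ℝ × E).1 = 0 from rfl, h2]
  exact (contMDiffOn_chart_real he).contMDiffAt (e.open_source.mem_nhds (e.map_target hz))

/-- For small times the flow in a chart is holomorphic. -/
theorem eventually_differentiableAt_flowChart (hT : IsHolomorphicAction E X r) (ξ : Fin r → ℝ)
    (he : e ∈ atlas E X) (hz : z ∈ e.target) :
    ∀ᶠ t : ℝ in 𝓝 0, DifferentiableAt ℂ (fun y => flowChart ξ e (t, y)) z := by
  have : IsManifold 𝓘(ℂ, E) 1 X := IsManifold.of_le (n := ω) le_top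
  have h1 : ContinuousAt (fun t : ℝ => torusExp (t • ξ) • e.symm z) 0 :=
    ContinuousAt.comp (x := (0 : ℝ)) (f := fun t : ℝ => (t, z))
      (g := fun p : ℝ × E => torusExp (p.1 • ξ) • e.symm p.2)
      (contMDiffAt_flow hT ξ he hz 0).continuousAt (by fun_prop)
  have h2 : torusExp ((0 : ℝ) • ξ) • e.symm z ∈ e.source := by
    rw [zero_smul, torusExp_zero, one_smul]
    exact e.map_target hz
  filter_upwards [h1.eventually (e.open_source.mem_nhds h2)] with t ht
  have h3 : MDifferentiableAt 𝓘(ℂ, E) 𝓘(ℂ, E) e.symm z := mdifferentiableAt_atlas_symm he hz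
  have h4 : MDifferentiableAt 𝓘(ℂ, E) 𝓘(ℂ, E) (fun x : X => torusExp (t • ξ) • x) (e.symm z) :=
    (hT.holomorphic (torusExp (t • ξ))).mdifferentiableAt (by simp)
  have h5 : MDifferentiableAt 𝓘(ℂ, E) 𝓘(ℂ, E) e (torusExp (t • ξ) • e.symm z) :=
    mdifferentiableAt_atlas he ht
  exact (h5.comp z (h4.comp z h3)).differentiableAt

theorem hasFDerivAt_fundField (hT : IsHolomorphicAction E X r) (ξ : Fin r → ℝ)
    (he : e ∈ atlas E X) (hz : z ∈ e.target) :
    HasFDerivAt (fundField ξ e) (((fderiv ℝ (fderiv ℝ (flowChart ξ e)) (0, z)).comp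
      (ContinuousLinearMap.inr ℝ ℝ E)).flip (1, 0)) z := by
  have h1 : fundField ξ e =ᶠ[𝓝 z] fun y => fderiv ℝ (flowChart ξ e) (0, y) (1, 0) := by
    filter_upwards [e.open_target.mem_nhds hz] with y hy
    have h2 := ((contDiffAt_flowChart hT ξ he hy).differentiableAt (by simp)).hasFDerivAt
    have h3 : HasDerivAt (fun t : ℝ => (t, y)) ((1 : ℝ), (0 : E)) 0 :=
      (hasDerivAt_id (0 : ℝ)).prodMk (hasDerivAt_const _ _)
    exact (h2.comp_hasDerivAt 0 h3).deriv
  refine HasFDerivAt.congr_of_eventuallyEq ?_ h1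
  have h4 := (differentiableAt_fderiv (contDiffAt_flowChart hT ξ he hz)).hasFDerivAt
  have h5 : HasFDerivAt (fun y : E => ((0 : ℝ), y)) (ContinuousLinearMap.inr ℝ ℝ E) z :=
    hasFDerivAt_prodMk_right 0 z
  refine ((h4.comp z h5).clm_apply (hasFDerivAt_const ((1 : ℝ), (0 : E)) z)).congr_fderiv ?_
  ext u
  simp

/-- By symmetry of second derivatives, the derivative of the fundamental field is the time
derivative of the derivative of the flow. -/
theorem hasDerivAt_fderiv_flowChart (hT : IsHolomorphicAction E X r) (ξ : Fin r → ℝ)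
    (he : e ∈ atlas E X) (hz : z ∈ e.target) (u : E) :
    HasDerivAt (fun t : ℝ => fderiv ℝ (flowChart ξ e) (t, z) (0, u))
      (fderiv ℝ (fundField ξ e) z u) 0 := by
  have hF := contDiffAt_flowChart hT ξ he hz
  have h1 : fderiv ℝ (fundField ξ e) z u =
      fderiv ℝ (fderiv ℝ (flowChart ξ e)) (0, z) (1, 0) (0, u) := by
    rw [(hasFDerivAt_fundField hT ξ he hz).fderiv, fderiv_fderiv_symm hF]
    rfl
  have h2 : HasFDerivAt (fun p => fderiv ℝ (flowChart ξ e) p (0, u))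
      ((fderiv ℝ (fderiv ℝ (flowChart ξ e)) (0, z)).flip (0, u)) (0, z) := by
    refine ((differentiableAt_fderiv hF).hasFDerivAt.clm_apply
      (hasFDerivAt_const ((0 : ℝ), u) (0, z))).congr_fderiv ?_
    ext p <;> simp
  have h3 : HasDerivAt (fun t : ℝ => (t, z)) ((1 : ℝ), (0 : E)) 0 :=
    (hasDerivAt_id (0 : ℝ)).prodMk (hasDerivAt_const _ _)
  rw [h1]
  exact h2.comp_hasDerivAt 0 h3

theorem eventually_fderiv_flowChart_J (hT : IsHolomorphicAction E X r) (ξ : Fin r → ℝ)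
    (he : e ∈ atlas E X) (hz : z ∈ e.target) (u : E) :
    (fun t : ℝ => fderiv ℝ (flowChart ξ e) (t, z) (0, J u)) =ᶠ[𝓝 0]
      fun t => J (fderiv ℝ (flowChart ξ e) (t, z) (0, u)) := by
  have hF := contDiffAt_flowChart hT ξ he hz
  have hc : ContinuousAt (fun t : ℝ => (t, z)) 0 := by fun_prop
  filter_upwards [eventually_differentiableAt_flowChart hT ξ he hz,
    hc.eventually (eventually_differentiableAt hF)]
    with t ht ht'
  have h6 : HasFDerivAt (fun y : E => (t, y)) (ContinuousLinearMap.inr ℝ ℝ E) z :=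
    hasFDerivAt_prodMk_right t z
  have h7 := (ht'.hasFDerivAt.comp z h6).unique (ht.hasFDerivAt.restrictScalars ℝ)
  have h8 : ∀ u, fderiv ℝ (flowChart ξ e) (t, z) (0, u) =
      fderiv ℂ (fun y => flowChart ξ e (t, y)) z u := fun u =>
    congrArg (fun l : E →L[ℝ] E => l u) h7
  rw [h8, h8, cplxJ_apply, cplxJ_apply, ContinuousLinearMap.map_smul]

/-- The fundamental vector fields of a holomorphic action are holomorphic. -/
theorem fderiv_fundField_J (hT : IsHolomorphicAction E X r) (ξ : Fin r → ℝ)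
    (he : e ∈ atlas E X) (hz : z ∈ e.target) (u : E) :
    fderiv ℝ (fundField ξ e) z (J u) = J (fderiv ℝ (fundField ξ e) z u) :=
  (hasDerivAt_fderiv_flowChart hT ξ he hz (J u)).unique
    (((cplxJ E).hasFDerivAt.comp_hasDerivAt 0
      (hasDerivAt_fderiv_flowChart hT ξ he hz u)).congr_of_eventuallyEq
        (eventually_fderiv_flowChart_J hT ξ he hz u))

end Action

end ComplexManifold

/-- The brackets of `ξ` with the coordinate fields are the negatives of the derivatives of `ξ`. -/
theorem lieCoeff_eq {E : Type*} [NormedAddCommGroup E] [NormedSpace ℂ E] [FiniteDimensional ℂ E]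
    {X : Type*} [TopologicalSpace X] {r : ℕ} [MulAction (Torus r) X] (ξ : Fin r → ℝ)
    (e : OpenPartialHomeomorph X E) (z : E) : lieCoeff ξ e z =
      -∑ j, (Module.finBasis ℂ E).coord j (fderiv ℝ (fundField ξ e) z (stdVec j)) := by
  rw [lieCoeff, ← Finset.sum_neg_distrib]
  refine Finset.sum_congr rfl fun j _ => ?_
  rw [VectorField.lieBracket_eq, ← map_neg]
  simp

/-! ### Functions on compact Kähler manifolds -/

section Compact

variable {E : Type*} [NormedAddCommGroup E] [NormedSpace ℂ E] [FiniteDimensional ℂ E]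
  {X : Type*} [TopologicalSpace X] [ChartedSpace E X] [IsManifold 𝓘(ℂ, E) ω X]

local notation "J" => cplxJ E

/-- A function on a compact connected Kähler manifold in the kernel of a drift Laplacian is
constant. -/
theorem KahlerMetric.exists_eq_const [CompactSpace X] [ConnectedSpace X] (Ω : KahlerMetric E X)
    {f φ : X → ℝ} (hf : ∀ e ∈ atlas E X, ContDiffOn ℝ ∞ (fun y => f (e.symm y)) e.target)
    (hφ : ∀ e ∈ atlas E X, ContDiffOn ℝ ∞ (fun y => φ (e.symm y)) e.target)
    (hL : ∀ e ∈ atlas E X, ∀ z ∈ e.target, -laplacian (Ω.loc e) (fun y => f (e.symm y)) z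
      + gradInner (Ω.loc e) (fun y => f (e.symm y)) (fun y => φ (e.symm y)) z = 0) :
    ∃ c, ∀ x, f x = c := by
  have hcont : Continuous f := continuous_iff_continuousAt.mpr fun x => by
    have hx := mem_chart_source E x
    have h1 : ContinuousAt (fun y => f ((chartAt E x).symm y)) (chartAt E x x) :=
      ((hf _ (chart_mem_atlas E x)).continuousOn).continuousAt
        ((chartAt E x).open_target.mem_nhds ((chartAt E x).map_source hx))
    refine (ContinuousAt.comp (f := chartAt E x) h1 ((chartAt E x).continuousAt hx)).congr ?_
    filter_upwards [(chartAt E x).open_source.mem_nhds hx] with y hy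
    simp [(chartAt E x).left_inv hy]
  obtain ⟨x₀, -, hx₀⟩ := isCompact_univ.exists_isMaxOn Set.univ_nonempty hcont.continuousOn
  have hclopen : IsClopen {x | f x = f x₀} := by
    refine ⟨isClosed_eq hcont continuous_const, isOpen_iff_eventually.mpr fun x hx => ?_⟩
    have he := chart_mem_atlas E x
    have hxs := mem_chart_source E x
    have h1 := eventually_eq_of_drift_laplacian_eq_zero (Ω.isKahlerOn he).toIsMetricOn (hf _ he)
      (hφ _ he) (hL _ he) (M := f x₀) (fun y _ => hx₀ (Set.mem_univ _))
      ((chartAt E x).map_source hxs) (by rw [(chartAt E x).left_inv hxs]; exact hx)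
    filter_upwards [((chartAt E x).continuousAt hxs).eventually h1,
      (chartAt E x).open_source.mem_nhds hxs] with y hy hys
    rwa [(chartAt E x).left_inv hys] at hy
  have huniv := hclopen.eq_univ ⟨x₀, rfl⟩
  exact ⟨f x₀, fun x => huniv.ge (Set.mem_univ x)⟩

/-- Pluriharmonic functions on a Kähler manifold are harmonic. -/
theorem laplacian_eq_zero_of_ddc_eq_zero {G : E → BilForm E} {S : Set E} {z : E}
    (hG : IsKahlerOn G S) (hz : z ∈ S) {f : E → ℝ} (hf : ContDiffAt ℝ ∞ f z)
    (h : ∀ u w, ddc f z u w = 0) : laplacian G f z = 0 := by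
  have h1 := hG.metricTrace_hessian hz f
  have h2 : ∀ u w, fderiv ℝ (fderiv ℝ f) z u w + fderiv ℝ (fderiv ℝ f) z (J u) (J w) = 0 :=
    fun u w => by
      have h3 := h (J u) w
      rw [ddc_apply hf, cplxJ_cplxJ, map_neg, fderiv_fderiv_symm hf w] at h3
      linarith
  simp only [h2] at h1
  have h4 : metricTrace (G z) (fun _ _ : E => (0 : ℝ)) = 0 := by simp [metricTrace]
  linarith

end Compact

end WeightedKahler

end

theorem proposition1 {E : Type*} [NormedAddCommGroup E] [NormedSpace ℂ E]
    [FiniteDimensional ℂ E] {r : ℕ} {X : Type*} [TopologicalSpace X] [T2Space X] [CompactSpace X]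
    [ConnectedSpace X] [ChartedSpace E X]
    [IsManifold 𝓘(ℂ, E) ω X]
    [MulAction (WeightedKahler.Torus r) X]
    (hT : WeightedKahler.IsHolomorphicAction E X r)
    (Ω : WeightedKahler.KahlerMetric E X)
    (hΩ : Ω.IsInvariant r) (hc : WeightedKahler.InTwoPiC1 Ω)
    (μ : X → WeightedKahler.TorusDual r) (hμ : WeightedKahler.IsCanonicalMomentumMap Ω μ)
    (v : WeightedKahler.TorusDual r → ℝ) (U : Set (WeightedKahler.TorusDual r))
    (hU : IsOpen U) (hμU : Set.range μ ⊆ U) (hv : ContDiffOn ℝ ∞ v U)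
    (hvpos : ∀ p ∈ Set.range μ, 0 < v p) :
    WeightedKahler.IsSoliton Ω μ v ↔
      WeightedKahler.IsWeightedCscK Ω μ v
        (fun p => 2 * ((Module.finrank ℂ E : ℝ) + fderiv ℝ (fun q => Real.log (v q)) p p) * v p) := by
  open WeightedKahler in
  obtain ⟨hmom, H, hcurv, hcan⟩ := hμ
  let φ : X → ℝ := fun x => Real.log (v (μ x))
  let f : X → ℝ := fun x => globalPotential Ω H x - φ x
  have hM : ∀ e ∈ atlas E X, ContDiffOn ℝ ∞ (fun y => μ (e.symm y)) e.target := fun e he =>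
    contDiffOn_comp_chart_symm hmom.smooth he
  have hφ : ∀ e ∈ atlas E X, ContDiffOn ℝ ∞ (fun y => φ (e.symm y)) e.target := fun e he =>
    (hv.comp (hM e he) fun y _ => hμU ⟨_, rfl⟩).log fun y _ => (hvpos _ ⟨_, rfl⟩).ne'
  have hκ : ∀ e ∈ atlas E X,
      ContDiffOn ℝ ∞ (ricciPotential (Ω.loc e) (H.logNorm e)) e.target := fun e he =>
    ricciPotential_contDiffOn (Ω.isKahlerOn he).toIsMetricOn (H.logNorm_contDiffOn he)
  have hfe : ∀ e ∈ atlas E X, ∀ y ∈ e.target,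
      f (e.symm y) = ricciPotential (Ω.loc e) (H.logNorm e) y - φ (e.symm y) := fun e he y hy => by
    simp only [f, ricciPotential_eq_globalPotential Ω H he hy]
  have hfev : ∀ e ∈ atlas E X, ∀ z ∈ e.target, (fun y => f (e.symm y)) =ᶠ[𝓝 z]
      fun y => ricciPotential (Ω.loc e) (H.logNorm e) y - φ (e.symm y) := fun e he z hz => by
    filter_upwards [e.open_target.mem_nhds hz] with y hy using hfe e he y hy
  have hf : ∀ e ∈ atlas E X, ContDiffOn ℝ ∞ (fun y => f (e.symm y)) e.target := fun e he =>
    ((hκ e he).sub (hφ e he)).congr (hfe e he)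
  -- the soliton equation says that `f` is pluriharmonic
  have hsol : ∀ e ∈ atlas E X, ∀ z ∈ e.target, ∀ u w,
      ricciForm (Ω.loc e) z u w - fundForm (Ω.loc e) z u w
        - (1 / 2) * ddc (fun y => Real.log (v (μ (e.symm y)))) z u w =
      1 / 2 * ddc (fun y => f (e.symm y)) z u w := fun e he z hz u w => by
    have hz' := e.open_target.mem_nhds hz
    have h1 : ddc (fun y => f (e.symm y)) z u w = _ :=
      (ddc_apply ((hf e he).contDiffAt hz') u w).trans (by
        rw [(hfev e he z hz).fderiv.fderiv_eq, ← ddc_apply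
          (((hκ e he).contDiffAt hz').sub ((hφ e he).contDiffAt hz')),
          ddc_sub ((hκ e he).contDiffAt hz') ((hφ e he).contDiffAt hz')])
    rw [(Ω.isKahlerOn he).ricciForm_sub_fundForm (H.logNorm_contDiffOn he) (hcurv e he) hz, h1]
    simp only [φ]
    ring
  -- the weighted scalar curvature equation says that a drift Laplacian of `f` vanishes
  have hcsc : ∀ e ∈ atlas E X, ∀ z ∈ e.target,
      weightedScal Ω μ v e z - 2 * ((Module.finrank ℂ E : ℝ) +
        fderiv ℝ (fun q => Real.log (v q)) (μ (e.symm z)) (μ (e.symm z))) * v (μ (e.symm z)) =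
      v (μ (e.symm z)) * (-laplacian (Ω.loc e) (fun y => f (e.symm y)) z
        + gradInner (Ω.loc e) (fun y => f (e.symm y)) (fun y => φ (e.symm y)) z) :=
    fun e he z hz => by
      rw [laplacian_congr (hfev e he z hz), gradInner_congr_left (hfev e he z hz)]
      exact (Ω.isKahlerOn he).weighted_scalarCurv_sub (H.logNorm_contDiffOn he) (hcurv e he) hz
        (hM e he) (ξ := fun i => fundField (Pi.single i (1 : ℝ)) e)
        (fun i x hx u => hmom.hamiltonian e he x hx _ u)
        (fun i => (hasFDerivAt_fundField hT _ he hz).differentiableAt)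
        (fun i u => fderiv_fundField_J hT _ he hz u)
        (fun i => by rw [← lieCoeff_eq]; exact hcan e he z hz _)
        hU (fun y _ => hμU ⟨_, rfl⟩) hv (fun y _ => hvpos _ ⟨_, rfl⟩)
  constructor
  · intro h
    have hddc : ∀ e ∈ atlas E X, ∀ z ∈ e.target, ∀ u w, ddc (fun y => f (e.symm y)) z u w = 0 :=
      fun e he z hz u w => by
        have h1 := hsol e he z hz u w
        rw [h e he z hz u w] at h1
        linarith
    obtain ⟨c, hc⟩ := Ω.exists_eq_const hf (φ := fun _ => 0) (fun _ _ => contDiffOn_const)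
      fun e he z hz => by
        rw [laplacian_eq_zero_of_ddc_eq_zero (Ω.isKahlerOn he) hz
          ((hf e he).contDiffAt (e.open_target.mem_nhds hz)) (hddc e he z hz)]
        simp [gradInner, metricTrace]
    intro e he z hz
    have h1 := hcsc e he z hz
    have h2 : (fun y => f (e.symm y)) = fun _ => c := funext fun y => hc _
    have h3 : laplacian (Ω.loc e) (fun _ => c) z = 0 := by
      unfold laplacian hessian
      simp [metricTrace]
    rw [h2, h3] at h1
    simp only [gradInner, fderiv_fun_const, Pi.zero_apply, _root_.zero_apply, zero_mul, metricTrace,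
      Finset.sum_const_zero, neg_zero, add_zero, mul_zero] at h1
    linarith
  · intro h
    obtain ⟨c, hc⟩ := Ω.exists_eq_const hf hφ fun e he z hz => by
      have h1 := hcsc e he z hz
      rw [h e he z hz, sub_self] at h1
      exact (mul_eq_zero.mp h1.symm).resolve_left (hvpos _ ⟨_, rfl⟩).ne'
    intro e he z hz u w
    have h1 := hsol e he z hz u w
    have h2 : (fun y => f (e.symm y)) = fun _ => c := funext fun y => hc _
    rw [h2, ddc_apply contDiffAt_const] at h1
    simp only [fderiv_fun_const, Pi.zero_apply, _root_.zero_apply, fderiv_zero, sub_zero,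
      mul_zero] at h1
    linarith
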